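/- Let $\alpha \in \mathbb{R}$ with $\alpha \neq 0$. For a bounded Lipschitz domain $\Omega \subset \mathbb{R}^2$, let $\lambda_1(\Omega;\alpha) \leq \lambda_2(\Omega;\alpha) \leq \dots$ denote the eigenvalues, counted with multiplicity, of the Robin Laplacian \[ -\Delta u = \lambda u \ \text{ in } \Omega, \qquad \frac{\partial u}{\partial \nu} + \alpha u = 0 \ \text{ on } \partial\Omega , \] that is, \[ \lambda_k(\Omega;\alpha) = \min_{U_k} \max_{u \in U_k \setminus \{0\}} \frac{\int_\Omega |\nabla u|^2 \, dx + \alpha \int_{\partial \Omega} u^2 \, dS}{\int_\Omega u^2 \, dx}, \qquad k = 1,2,\dots , \] where $U_k$ ranges over all $k$-dimensional subspaces of $H^1(\Omega)$. (On $\partial\Omega$, $u$ is understood in the sense of traces.) Then each (nondegenerate, open) rectangle is determined up to congruence by its first two Robin eigenvalues: if $\mathcal{R}, \mathcal{S} \subset \mathbb{R}^2$ are rectangles, in arbitrary position and orientation, with \[ \lambda_1(\mathcal{R};\alpha) = \lambda_1(\mathcal{S};\alpha) \quad \text{and} \quad \lambda_2(\mathcal{R};\alpha) = \lambda_2(\mathcal{S};\alpha),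 \] then $\mathcal{R}$ and $\mathcal{S}$ are congruent, that is, some isometry of $\mathbb{R}^2$ maps $\mathcal{R}$ onto $\mathcal{S}$. -/

import Mathlib

open MeasureTheory Filter Topology
open scoped ContDiff

/-- The Euclidean plane. -/
abbrev Plane : Type := EuclideanSpace ℝ (Fin 2)

/-- Arc length measure on the boundary `∂Ω`: one-dimensional Hausdorff measure restricted to the
topological boundary (Mathlib normalizes it so that a segment gets its length). -/
noncomputable def boundaryMeasure (Ω : Set Plane) : Measure Plane :=
  (Measure.hausdorffMeasure 1).restrict (frontier Ω)

/-- `G` is the weak gradient of `u` on the open set `Ω`: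
`∫_Ω u ∇φ = - ∫_Ω φ G` for all test functions `φ ∈ C_c^∞(Ω)`. -/
def IsWeakGradient (Ω : Set Plane) (u : Plane → ℝ) (G : Plane → Plane) : Prop :=
  ∀ φ : Plane → ℝ, ContDiff ℝ ∞ φ → HasCompactSupport φ → tsupport φ ⊆ Ω →
    ∫ x in Ω, u x • gradient φ x = - ∫ x in Ω, φ x • G x

/-- `g ∈ L²(∂Ω)` is the boundary trace of the Sobolev function `u` with weak gradient `G`:
there are functions `φ_m`, smooth up to the boundary, which converge to `u` in `H¹(Ω)` and whose
boundary values converge to `g` in `L²(∂Ω)`. On a bounded Lipschitz domain every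
`u ∈ H¹(Ω)` has exactly one trace. -/
def IsTrace (Ω : Set Plane) (u : Plane → ℝ) (G : Plane → Plane) (g : Plane → ℝ) : Prop :=
  ∃ φ : ℕ → Plane → ℝ, (∀ m, ContDiff ℝ ∞ (φ m)) ∧
    Tendsto (fun m => eLpNorm (fun x => φ m x - u x) 2 (volume.restrict Ω)) atTop (𝓝 0) ∧
    Tendsto (fun m => eLpNorm (fun x => gradient (φ m) x - G x) 2 (volume.restrict Ω))
      atTop (𝓝 0) ∧
    Tendsto (fun m => eLpNorm (fun x => φ m x - g x) 2 (boundaryMeasure Ω)) atTop (𝓝 0)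

/-- The ambient space `L²(Ω) × L²(Ω; ℝ²) × L²(∂Ω)` for triples `(u, ∇u, trace of u)`. -/
abbrev L2Triple (Ω : Set Plane) : Type :=
  Lp ℝ 2 (volume.restrict Ω) × Lp Plane 2 (volume.restrict Ω) × Lp ℝ 2 (boundaryMeasure Ω)

/-- The Sobolev space `H¹(Ω)`, each of its functions `u ∈ L²(Ω)` being recorded along with its
weak gradient in `L²(Ω; ℝ²)` and its trace in `L²(∂Ω)`, which are determined by `u`
when `Ω` is a bounded Lipschitz domain. -/
def sobolevH1 (Ω : Set Plane) : Set (L2Triple Ω) :=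
  {p | IsWeakGradient Ω p.1 p.2.1 ∧ IsTrace Ω p.1 p.2.1 p.2.2}

/-- The Robin Rayleigh quotient `(∫_Ω |∇u|² + α ∫_{∂Ω} u² dS) / ∫_Ω u²`. -/
noncomputable def robinRayleigh (Ω : Set Plane) (α : ℝ) (p : L2Triple Ω) : ℝ :=
  ((∫ x in Ω, ‖p.2.1 x‖ ^ 2) + α * ∫ x, p.2.2 x ^ 2 ∂(boundaryMeasure Ω)) /
    ∫ x in Ω, p.1 x ^ 2

/-- The `k`-th eigenvalue (`k = 1, 2, …`, counted with multiplicity) of the Robin Laplacian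
`-Δu = λu` in `Ω`, `∂u/∂ν + αu = 0` on `∂Ω`, given by the minimax principle: the least value, over
all `k`-dimensional subspaces `U` of `H¹(Ω)`, of the maximum of the Rayleigh quotient
over `U \ {0}`. -/
noncomputable def robinEigenvalue (Ω : Set Plane) (α : ℝ) (k : ℕ) : ℝ :=
  sInf {M : ℝ | ∃ U : Submodule ℝ (L2Triple Ω), (U : Set (L2Triple Ω)) ⊆ sobolevH1 Ω ∧
    Module.finrank ℝ U = k ∧ IsGreatest {r | ∃ p ∈ U, p ≠ 0 ∧ r = robinRayleigh Ω α p} M}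

/-- Two plane sets are congruent if some isometry of the plane maps one onto the other. -/
def AreCongruent (R S : Set Plane) : Prop :=
  ∃ e : Plane ≃ᵢ Plane, e '' R = S

/-- A rectangle: a plane set congruent to a product `(0, a) × (0, b)` of open intervals with
`a, b > 0`. Its position and orientation are arbitrary. -/
def IsRectangle (R : Set Plane) : Prop :=
  ∃ a b : ℝ, 0 < a ∧ 0 < b ∧
    AreCongruent {x : Plane | x 0 ∈ Set.Ioo 0 a ∧ x 1 ∈ Set.Ioo 0 b} R

/-! Separation of variables reduces the claim to intervals. On `[-ℓ, ℓ]` let `μ(ℓ)` be the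
eigenvalue of a positive Robin ground state and `ν(ℓ)` that of a mode with its only zero at the
midpoint. For half-sides `m ≤ ℓ` the first eigenvalue of the rectangle is `μ(ℓ) + μ(m)`. The second
one excites the direction with the smaller gap `ν - μ`. This gap decreases strictly with length, so
the excited direction is the long side, and `λ₂ = ν(ℓ) + μ(m)`. Hence `λ₂ - λ₁ = ν(ℓ) - μ(ℓ)`
determines `ℓ`, and then `μ(m) = λ₁ - μ(ℓ)` determines `m`, because `μ` is strictly monotone:
decreasing for `α > 0`, increasing for `α < 0`.

The crux is the monotonicity of the gap (`gap_lt`). For `α < 0`, `μ` increases and `ν` decreases.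
For `α > 0` both decrease, and `gap_lt_of_pos` compares the functions `p = v (w/v)'`, where `v` is
the ground state and `w` the odd mode: `p` satisfies a Dirichlet problem `-p'' + (2 (v'/v)² + μ) p =
(ν - μ) p`, whose potential decreases as the interval grows.

The eigenvalues in the statement are minimax values over `H¹`, so they have to be identified with
these sums. No spectral theorem or compactness is used. Jacobi's identity writes the Robin energy as
`μ ∫ f²` plus the square of a first-order expression. This yields the bound below by `μ` and a
quantitative bound by `ν` modulo the ground state (`EvenGround.gap_inequality`). Integrating over
slices gives the corresponding planar inequalities (`second_robin_inequality`), which extend from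
smooth functions to `H¹` by continuity; products of one-dimensional modes give equality. -/

open Set

/-! ### The Robin problem on an interval: Jacobi's identity and its inequalities -/

/-- A positive solution of `-v'' = μ v` on `[-ℓ, ℓ]` with the Robin boundary conditions. -/
structure EvenGround (α ℓ μ : ℝ) (v v' : ℝ → ℝ) : Prop where
  hasDeriv : ∀ x, HasDerivAt v (v' x) x
  hasDeriv' : ∀ x, HasDerivAt v' (-μ * v x) x
  pos : ∀ x ∈ Icc (-ℓ) ℓ, 0 < v x
  deriv_zero : v' 0 = 0
  right : v' ℓ = -α * v ℓ
  left : v' (-ℓ) = α * v (-ℓ)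

/-- A solution of `-v'' = μ v` on `[-ℓ, ℓ]` with the Robin boundary conditions, vanishing at `0`
and positive to the right of it. -/
structure OddGround (α ℓ μ : ℝ) (v v' : ℝ → ℝ) : Prop where
  hasDeriv : ∀ x, HasDerivAt v (v' x) x
  hasDeriv' : ∀ x, HasDerivAt v' (-μ * v x) x
  zero : v 0 = 0
  deriv_pos : 0 < v' 0
  pos : ∀ x ∈ Ioc 0 ℓ, 0 < v x
  right : v' ℓ = -α * v ℓ
  left : v' (-ℓ) = α * v (-ℓ)

/-- The Robin energy of `f`, with derivative `f'`, on the interval `[-ℓ, ℓ]`. -/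
noncomputable def robinForm (α ℓ : ℝ) (f f' : ℝ → ℝ) : ℝ :=
  (∫ x in (-ℓ)..ℓ, f' x ^ 2) + α * (f ℓ ^ 2 + f (-ℓ) ^ 2)

theorem continuous_of_hasDerivAt {f f' : ℝ → ℝ} (h : ∀ x, HasDerivAt f (f' x) x) :
    Continuous f :=
  continuous_iff_continuousAt.2 fun x => (h x).continuousAt

/-- Jacobi's identity. -/
theorem jacobi_identity {a b μ : ℝ} (hab : a ≤ b) {v v' f f' : ℝ → ℝ}
    (hv : ∀ x, HasDerivAt v (v' x) x) (hv' : ∀ x, HasDerivAt v' (-μ * v x) x)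
    (hne : ∀ x ∈ Icc a b, v x ≠ 0)
    (hf : ∀ x, HasDerivAt f (f' x) x) (hf' : Continuous f') :
    (∫ x in a..b, f' x ^ 2) = (∫ x in a..b, (f' x - v' x / v x * f x) ^ 2)
      + μ * (∫ x in a..b, f x ^ 2) + (v' b / v b * f b ^ 2 - v' a / v a * f a ^ 2) := by
  have cv := continuous_of_hasDerivAt hv
  have cv' := continuous_of_hasDerivAt hv'
  have cf := continuous_of_hasDerivAt hf
  have hr : ContinuousOn (fun x => v' x / v x) (Icc a b) :=
    cv'.continuousOn.div cv.continuousOn hne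
  have hE : ContinuousOn (fun x => (f' x - v' x / v x * f x) ^ 2) (uIcc a b) := by
    rw [uIcc_of_le hab]
    exact (hf'.continuousOn.sub (hr.mul cf.continuousOn)).pow 2
  have hD : ContinuousOn (fun x => f' x ^ 2 - (f' x - v' x / v x * f x) ^ 2 - μ * f x ^ 2)
      (uIcc a b) := by
    refine ((hf'.pow 2).continuousOn.sub hE).sub ?_
    exact (continuous_const.mul (cf.pow 2)).continuousOn
  -- With `r = v' / v`, the Riccati equation `r' = -μ - r²` makes this integrand the derivative of
  -- `r f²`.
  have key : ∫ x in a..b, (f' x ^ 2 - (f' x - v' x / v x * f x) ^ 2 - μ * f x ^ 2)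
      = v' b / v b * f b ^ 2 - v' a / v a * f a ^ 2 := by
    refine intervalIntegral.integral_eq_sub_of_hasDerivAt
      (f := fun x => v' x / v x * f x ^ 2) (fun x hx => ?_) hD.intervalIntegrable
    rw [uIcc_of_le hab] at hx
    have h0 := hne x hx
    refine (((hv' x).div (hv x) h0).mul ((hf x).pow 2)).congr_deriv ?_
    simp only [Pi.pow_apply, Pi.div_apply]
    field_simp
    ring
  rw [intervalIntegral.integral_sub, intervalIntegral.integral_sub,
    intervalIntegral.integral_const_mul] at key
  · linarith
  · exact (hf'.pow 2).intervalIntegrable _ _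
  · exact hE.intervalIntegrable
  · exact (((hf'.pow 2).continuousOn).sub hE).intervalIntegrable
  · exact (continuous_const.mul (cf.pow 2)).intervalIntegrable _ _

/-- The boundary conditions say `v' / v = -α` at `ℓ` and `α` at `-ℓ`, so the boundary terms of
Jacobi's identity cancel the Robin terms exactly. -/
theorem EvenGround.robinForm_eq {α ℓ μ : ℝ} (hℓ : 0 < ℓ) {v v' f f' : ℝ → ℝ}
    (h : EvenGround α ℓ μ v v') (hf : ∀ x, HasDerivAt f (f' x) x) (hf' : Continuous f') :
    robinForm α ℓ f f' = (∫ x in (-ℓ)..ℓ, (f' x - v' x / v x * f x) ^ 2)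
      + μ * ∫ x in (-ℓ)..ℓ, f x ^ 2 := by
  have hne : ∀ x ∈ Icc (-ℓ) ℓ, v x ≠ 0 := fun x hx => (h.pos x hx).ne'
  rw [robinForm, jacobi_identity (by linarith) h.hasDeriv h.hasDeriv' hne hf hf', h.right, h.left]
  have h1 := hne ℓ ⟨by linarith, le_rfl⟩
  have h2 := hne (-ℓ) ⟨le_rfl, by linarith⟩
  rw [mul_div_cancel_right₀ _ h1, mul_div_cancel_right₀ _ h2]
  ring

theorem EvenGround.le_robinForm {α ℓ μ : ℝ} (hℓ : 0 < ℓ) {v v' f f' : ℝ → ℝ}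
    (h : EvenGround α ℓ μ v v') (hf : ∀ x, HasDerivAt f (f' x) x) (hf' : Continuous f') :
    μ * ∫ x in (-ℓ)..ℓ, f x ^ 2 ≤ robinForm α ℓ f f' := by
  rw [h.robinForm_eq hℓ hf hf']
  have : 0 ≤ ∫ x in (-ℓ)..ℓ, (f' x - v' x / v x * f x) ^ 2 :=
    intervalIntegral.integral_nonneg (by linarith) fun x _ => sq_nonneg _
  linarith

/-- Jacobi's identity fails at the zero of `v`, so it is applied on `[ε, ℓ]` with `ε → 0`. The
singular boundary term `(v' / v) f²` tends to `0` because `f` vanishes there too. -/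
theorem OddGround.half_le {α ℓ μ : ℝ} (hℓ : 0 < ℓ) {v v' f f' : ℝ → ℝ}
    (h : OddGround α ℓ μ v v') (hf : ∀ x, HasDerivAt f (f' x) x) (hf' : Continuous f')
    (hf0 : f 0 = 0) :
    μ * ∫ x in 0..ℓ, f x ^ 2 ≤ (∫ x in 0..ℓ, f' x ^ 2) + α * f ℓ ^ 2 := by
  have cf := continuous_of_hasDerivAt hf
  have cv' := continuous_of_hasDerivAt h.hasDeriv'
  have T : ∀ g : ℝ → ℝ, Continuous g →
      Tendsto (fun ε => ∫ x in ε..ℓ, g x) (𝓝[>] 0) (𝓝 (∫ x in 0..ℓ, g x)) := by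
    intro g hg
    have : Continuous fun ε => ∫ x in ε..ℓ, g x := by
      simp_rw [intervalIntegral.integral_symm ℓ]
      exact (intervalIntegral.continuous_primitive (fun a b => hg.intervalIntegrable a b) ℓ).neg
    exact (this.tendsto 0).mono_left nhdsWithin_le_nhds
  have hslope : ∀ {g g' : ℝ → ℝ}, (∀ x, HasDerivAt g (g' x) x) → g 0 = 0 →
      Tendsto (fun x => g x / x) (𝓝[>] 0) (𝓝 (g' 0)) := by
    intro g g' hg h0
    have := (hasDerivAt_iff_tendsto_slope.1 (hg 0)).mono_left
      (nhdsWithin_mono _ fun x (hx : (0:ℝ) < x) => hx.ne')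
    refine this.congr fun x => ?_
    simp [slope_def_field, h0]
  -- The term is the product of `v'`, the quotient of the slopes `f / ε` and `v / ε`, and `f`; the
  -- first two have finite limits and `f → 0`.
  have B : Tendsto (fun ε => v' ε / v ε * f ε ^ 2) (𝓝[>] 0) (𝓝 0) := by
    have h1 := ((hslope hf hf0).div (hslope h.hasDeriv h.zero) h.deriv_pos.ne')
    have h2 : Tendsto v' (𝓝[>] 0) (𝓝 (v' 0)) := (cv'.tendsto 0).mono_left nhdsWithin_le_nhds
    have h3 : Tendsto f (𝓝[>] 0) (𝓝 0) := by
      simpa [hf0] using (cf.tendsto 0).mono_left (nhdsWithin_le_nhds (s := Ioi 0))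
    have := (h2.mul h1).mul h3
    rw [mul_zero] at this
    refine this.congr' ?_
    filter_upwards [Ioc_mem_nhdsGT hℓ] with x hx
    have := (h.pos x hx).ne'
    have := hx.1.ne'
    simp only [Pi.div_apply]
    field_simp
  have L1 := (T _ (cf.pow 2)).const_mul μ
  have L2 := ((T _ (hf'.pow 2)).add_const (α * f ℓ ^ 2)).add B
  rw [add_zero] at L2
  refine le_of_tendsto_of_tendsto L1 L2 ?_
  filter_upwards [Ioc_mem_nhdsGT hℓ] with ε hε
  have hne : ∀ x ∈ Icc ε ℓ, v x ≠ 0 := fun x hx => (h.pos x ⟨hε.1.trans_le hx.1, hx.2⟩).ne'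
  have J := jacobi_identity hε.2 h.hasDeriv h.hasDeriv' hne hf hf'
  have : 0 ≤ ∫ x in ε..ℓ, (f' x - v' x / v x * f x) ^ 2 :=
    intervalIntegral.integral_nonneg hε.2 fun x _ => sq_nonneg _
  rw [h.right, mul_div_cancel_right₀ _ (hne ℓ ⟨hε.2, le_rfl⟩)] at J
  simp only [Pi.pow_apply]
  linarith

theorem OddGround.le_robinForm {α ℓ μ : ℝ} (hℓ : 0 < ℓ) {v v' f f' : ℝ → ℝ}
    (h : OddGround α ℓ μ v v') (hf : ∀ x, HasDerivAt f (f' x) x) (hf' : Continuous f')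
    (hf0 : f 0 = 0) :
    μ * ∫ x in (-ℓ)..ℓ, f x ^ 2 ≤ robinForm α ℓ f f' := by
  have cf := continuous_of_hasDerivAt hf
  have A := h.half_le hℓ hf hf' hf0
  have hg : ∀ x, HasDerivAt (fun x => f (-x)) (-f' (-x)) x := fun x => by
    simpa [Function.comp_def] using (hf (-x)).comp x (hasDerivAt_neg x)
  have B := h.half_le hℓ hg (hf'.comp continuous_neg).neg (by simpa using hf0)
  have e1 : ∫ x in 0..ℓ, f (-x) ^ 2 = ∫ x in (-ℓ)..0, f x ^ 2 := by
    simpa using intervalIntegral.integral_comp_neg (fun x => f x ^ 2) (a := 0) (b := ℓ)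
  have e2 : ∫ x in 0..ℓ, (-f' (-x)) ^ 2 = ∫ x in (-ℓ)..0, f' x ^ 2 := by
    simpa using intervalIntegral.integral_comp_neg (fun x => f' x ^ 2) (a := 0) (b := ℓ)
  rw [e1, e2] at B
  have s1 := intervalIntegral.integral_add_adjacent_intervals
    ((cf.pow 2).intervalIntegrable (μ := volume) (-ℓ) 0)
    ((cf.pow 2).intervalIntegrable (μ := volume) 0 ℓ)
  have s2 := intervalIntegral.integral_add_adjacent_intervals
    ((hf'.pow 2).intervalIntegrable (μ := volume) (-ℓ) 0)
    ((hf'.pow 2).intervalIntegrable (μ := volume) 0 ℓ)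
  simp only [Pi.pow_apply] at s1 s2
  rw [robinForm, ← s1, ← s2]
  linarith

theorem integral_sub_mul_sq {a b : ℝ} {f g : ℝ → ℝ} (hf : Continuous f) (hg : Continuous g)
    (t : ℝ) : ∫ x in a..b, (f x - t * g x) ^ 2 =
      (∫ x in a..b, f x ^ 2) - 2 * t * (∫ x in a..b, f x * g x) + t ^ 2 * ∫ x in a..b, g x ^ 2 := by
  have : ∀ x, (f x - t * g x) ^ 2 = f x ^ 2 - 2 * t * (f x * g x) + t ^ 2 * g x ^ 2 := fun x => by
    ring
  simp_rw [this]
  rw [intervalIntegral.integral_add, intervalIntegral.integral_sub,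
    intervalIntegral.integral_const_mul, intervalIntegral.integral_const_mul]
  all_goals exact Continuous.intervalIntegrable (by fun_prop) _ _

/-- The left side is the squared distance from `f` to the line spanned by `g`; the difference of the
two sides is a square in `t`. -/
theorem sub_div_le_integral_sub_mul_sq {a b : ℝ} {f g : ℝ → ℝ} (hf : Continuous f)
    (hg : Continuous g) (hpos : 0 < ∫ x in a..b, g x ^ 2) (t : ℝ) :
    (∫ x in a..b, f x ^ 2) - (∫ x in a..b, f x * g x) ^ 2 / (∫ x in a..b, g x ^ 2) ≤
      ∫ x in a..b, (f x - t * g x) ^ 2 := by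
  rw [integral_sub_mul_sq hf hg]
  have : 0 ≤ ((∫ x in a..b, f x * g x) - t * ∫ x in a..b, g x ^ 2) ^ 2 / ∫ x in a..b, g x ^ 2 := by
    positivity
  have e : ((∫ x in a..b, f x * g x) - t * ∫ x in a..b, g x ^ 2) ^ 2 / (∫ x in a..b, g x ^ 2) =
    (∫ x in a..b, f x * g x) ^ 2 / (∫ x in a..b, g x ^ 2) - 2 * t * (∫ x in a..b, f x * g x)
      + t ^ 2 * ∫ x in a..b, g x ^ 2 := by
    field_simp
    ring
  linarith

theorem integral_mul_sq_div_le {a b : ℝ} (hab : a ≤ b) {f g : ℝ → ℝ} (hf : ContinuousOn f (Icc a b))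
    (hg : Continuous g) (hpos : 0 < ∫ x in a..b, g x ^ 2) :
    (∫ x in a..b, f x * g x) ^ 2 / (∫ x in a..b, g x ^ 2) ≤ ∫ x in a..b, f x ^ 2 := by
  set F := IccExtend hab ((Icc a b).domRestrict f)
  have hF : Continuous F := (continuousOn_iff_continuous_domRestrict.1 hf).Icc_extend'
  have e : ∀ x ∈ Icc a b, F x = f x := fun x hx => by simp [F, IccExtend_of_mem hab _ hx, Set.domRestrict]
  have e1 : ∫ x in a..b, f x * g x = ∫ x in a..b, F x * g x :=
    intervalIntegral.integral_congr fun x hx => by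
      rw [uIcc_of_le hab] at hx; simp only [e x hx]
  have e2 : ∫ x in a..b, f x ^ 2 = ∫ x in a..b, F x ^ 2 :=
    intervalIntegral.integral_congr fun x hx => by
      rw [uIcc_of_le hab] at hx; simp only [e x hx]
  rw [e1, e2]
  have h := integral_sub_mul_sq (a := a) (b := b) hF hg
    ((∫ x in a..b, F x * g x) / (∫ x in a..b, g x ^ 2))
  have h0 : 0 ≤ ∫ x in a..b, (F x - (∫ x in a..b, F x * g x) / (∫ x in a..b, g x ^ 2) * g x) ^ 2 :=
    intervalIntegral.integral_nonneg hab fun x _ => sq_nonneg _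
  rw [h] at h0
  have : (∫ x in a..b, F x ^ 2) - 2 * ((∫ x in a..b, F x * g x) / (∫ x in a..b, g x ^ 2)) *
      (∫ x in a..b, F x * g x) + ((∫ x in a..b, F x * g x) / (∫ x in a..b, g x ^ 2)) ^ 2 *
      (∫ x in a..b, g x ^ 2) = (∫ x in a..b, F x ^ 2) -
      (∫ x in a..b, F x * g x) ^ 2 / (∫ x in a..b, g x ^ 2) := by
    field_simp
    ring
  linarith

theorem EvenGround.integral_sq_pos {α ℓ μ : ℝ} (hℓ : 0 < ℓ) {v v' : ℝ → ℝ}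
    (h : EvenGround α ℓ μ v v') : 0 < ∫ x in (-ℓ)..ℓ, v x ^ 2 :=
  intervalIntegral.intervalIntegral_pos_of_pos_on
    (((continuous_of_hasDerivAt h.hasDeriv).pow 2).intervalIntegrable _ _)
    (fun x hx => pow_pos (h.pos x ⟨hx.1.le, hx.2.le⟩) 2) (by linarith)

theorem OddGround.integral_sq_pos {α ℓ μ : ℝ} (hℓ : 0 < ℓ) {v v' : ℝ → ℝ}
    (h : OddGround α ℓ μ v v') : 0 < ∫ x in (-ℓ)..ℓ, v x ^ 2 := by
  have c : Continuous fun x => v x ^ 2 := (continuous_of_hasDerivAt h.hasDeriv).pow 2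
  rw [← intervalIntegral.integral_add_adjacent_intervals (b := 0)
    (c.intervalIntegrable _ _) (c.intervalIntegrable _ _)]
  refine add_pos_of_nonneg_of_pos
    (intervalIntegral.integral_nonneg (by linarith) fun x _ => sq_nonneg _) ?_
  exact intervalIntegral.intervalIntegral_pos_of_pos_on
    (c.intervalIntegrable _ _) (fun x hx => pow_pos (h.pos x ⟨hx.1, hx.2.le⟩) 2) hℓ

theorem hasDerivAt_wronskian {v v' w w' : ℝ → ℝ} {μ ν x : ℝ} (hv : HasDerivAt v (v' x) x)
    (hv' : HasDerivAt v' (-μ * v x) x) (hw : HasDerivAt w (w' x) x)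
    (hw' : HasDerivAt w' (-ν * w x) x) :
    HasDerivAt (fun x => v x * w' x - v' x * w x) ((μ - ν) * (v x * w x)) x := by
  refine ((hv.mul hw').sub (hv'.mul hw)).congr_deriv ?_
  ring

/-- The Wronskian `v w' - v' w` is positive at `0` and vanishes at `ℓ`, where both functions satisfy
the same Robin condition. If `ν ≤ μ` it could not decrease. -/
theorem EvenGround.lt_of_oddGround {α ℓ μ ν : ℝ} (hℓ : 0 < ℓ) {v v' w w' : ℝ → ℝ}
    (h : EvenGround α ℓ μ v v') (k : OddGround α ℓ ν w w') : μ < ν := by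
  by_contra! hc
  have W := fun x => hasDerivAt_wronskian (h.hasDeriv x) (h.hasDeriv' x) (k.hasDeriv x)
    (k.hasDeriv' x)
  have mono : MonotoneOn (fun x => v x * w' x - v' x * w x) (Icc 0 ℓ) := by
    refine monotoneOn_of_hasDerivWithinAt_nonneg (convex_Icc _ _)
      (continuous_of_hasDerivAt W).continuousOn (fun x _ => (W x).hasDerivWithinAt) ?_
    intro x hx
    rw [interior_Icc] at hx
    have := h.pos x ⟨by linarith [hx.1], hx.2.le⟩
    have := k.pos x ⟨hx.1, hx.2.le⟩
    have := sub_nonneg.2 hc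
    positivity
  have := mono (left_mem_Icc.2 hℓ.le) (right_mem_Icc.2 hℓ.le) hℓ.le
  simp only [k.zero, h.right, k.right] at this
  have := mul_pos (h.pos 0 ⟨by linarith, hℓ.le⟩) k.deriv_pos
  linarith

/-- Symmetry of the Robin problem is used rather than parity: the Wronskian vanishes at both ends,
and `μ ≠ ν`. -/
theorem EvenGround.integral_mul_eq_zero {α ℓ μ ν : ℝ} (hℓ : 0 < ℓ) {v v' w w' : ℝ → ℝ}
    (h : EvenGround α ℓ μ v v') (k : OddGround α ℓ ν w w') :
    ∫ x in (-ℓ)..ℓ, v x * w x = 0 := by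
  have cv := continuous_of_hasDerivAt h.hasDeriv
  have cw := continuous_of_hasDerivAt k.hasDeriv
  have W := fun x => hasDerivAt_wronskian (h.hasDeriv x) (h.hasDeriv' x) (k.hasDeriv x)
    (k.hasDeriv' x)
  have := intervalIntegral.integral_eq_sub_of_hasDerivAt (a := -ℓ) (b := ℓ) (fun x _ => W x)
    (Continuous.intervalIntegrable (by fun_prop) _ _)
  rw [intervalIntegral.integral_const_mul, h.right, k.right, h.left, k.left] at this
  have hne := (sub_neg.2 (h.lt_of_oddGround hℓ k)).ne
  refine (mul_eq_zero.1 (this.trans ?_)).resolve_left hne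
  ring

/-- Subtracting `t v` from `f` leaves the square in Jacobi's identity unchanged. Choosing `t` so
that the difference vanishes at `0` makes the inequality for odd modes applicable, and no choice of
`t` brings `f` closer to the line of `v` than its projection does. -/
theorem EvenGround.gap_inequality {α ℓ μ ν : ℝ} (hℓ : 0 < ℓ) {v v' w w' f f' : ℝ → ℝ}
    (h : EvenGround α ℓ μ v v') (k : OddGround α ℓ ν w w')
    (hf : ∀ x, HasDerivAt f (f' x) x) (hf' : Continuous f') :
    (ν - μ) * ((∫ x in (-ℓ)..ℓ, f x ^ 2) -
      (∫ x in (-ℓ)..ℓ, f x * v x) ^ 2 / ∫ x in (-ℓ)..ℓ, v x ^ 2) ≤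
      ∫ x in (-ℓ)..ℓ, (f' x - v' x / v x * f x) ^ 2 := by
  have cf := continuous_of_hasDerivAt hf
  have cv := continuous_of_hasDerivAt h.hasDeriv
  have cv' := continuous_of_hasDerivAt h.hasDeriv'
  set t := f 0 / v 0 with ht
  have hv0 := h.pos 0 ⟨by linarith, hℓ.le⟩
  have hg : ∀ x, HasDerivAt (fun x => f x - t * v x) (f' x - t * v' x) x := fun x =>
    (hf x).sub ((h.hasDeriv x).const_mul t)
  have hg' : Continuous fun x => f' x - t * v' x := by fun_prop
  have A := k.le_robinForm hℓ hg hg' (by rw [ht]; field_simp; ring)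
  rw [h.robinForm_eq hℓ hg hg'] at A
  have e : ∫ x in (-ℓ)..ℓ, (f' x - t * v' x - v' x / v x * (f x - t * v x)) ^ 2 =
      ∫ x in (-ℓ)..ℓ, (f' x - v' x / v x * f x) ^ 2 := by
    refine intervalIntegral.integral_congr fun x hx => ?_
    rw [uIcc_of_le (by linarith)] at hx
    have := (h.pos x hx).ne'
    congr 1
    field_simp
    ring
  rw [e] at A
  have B := sub_div_le_integral_sub_mul_sq cf cv (h.integral_sq_pos hℓ) t
  have := mul_le_mul_of_nonneg_left B (sub_pos.2 (h.lt_of_oddGround hℓ k)).le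
  linarith

/-- The fundamental theorem of calculus for `u u'`, with `u = s v + t w`, produces the Robin
boundary terms; orthogonality removes the cross term. -/
theorem EvenGround.robinForm_add {α ℓ μ ν : ℝ} (hℓ : 0 < ℓ) {v v' w w' : ℝ → ℝ}
    (h : EvenGround α ℓ μ v v') (k : OddGround α ℓ ν w w') (s t : ℝ) :
    robinForm α ℓ (fun x => s * v x + t * w x) (fun x => s * v' x + t * w' x) =
      s ^ 2 * (μ * ∫ x in (-ℓ)..ℓ, v x ^ 2) + t ^ 2 * (ν * ∫ x in (-ℓ)..ℓ, w x ^ 2) := by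
  have cv := continuous_of_hasDerivAt h.hasDeriv
  have cv' := continuous_of_hasDerivAt h.hasDeriv'
  have cw := continuous_of_hasDerivAt k.hasDeriv
  have cw' := continuous_of_hasDerivAt k.hasDeriv'
  have D : ∀ x, HasDerivAt (fun x => (s * v x + t * w x) * (s * v' x + t * w' x))
      ((s * v' x + t * w' x) ^ 2 - (s ^ 2 * μ * v x ^ 2 + t ^ 2 * ν * w x ^ 2 +
        s * t * (μ + ν) * (v x * w x))) x := fun x => by
    refine ((((h.hasDeriv x).const_mul s).add ((k.hasDeriv x).const_mul t)).mul
      (((h.hasDeriv' x).const_mul s).add ((k.hasDeriv' x).const_mul t))).congr_deriv ?_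
    simp only [Pi.add_apply]
    ring
  have I := intervalIntegral.integral_eq_sub_of_hasDerivAt (a := -ℓ) (b := ℓ) (fun x _ => D x)
    (Continuous.intervalIntegrable (by fun_prop) _ _)
  rw [intervalIntegral.integral_sub, intervalIntegral.integral_add, intervalIntegral.integral_add,
    intervalIntegral.integral_const_mul, intervalIntegral.integral_const_mul,
    intervalIntegral.integral_const_mul, h.integral_mul_eq_zero hℓ k, h.right, h.left, k.right,
    k.left] at I
  · rw [robinForm]
    linarith
  all_goals exact Continuous.intervalIntegrable (by fun_prop) _ _

theorem EvenGround.integral_add_sq {α ℓ μ ν : ℝ} (hℓ : 0 < ℓ) {v v' w w' : ℝ → ℝ}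
    (h : EvenGround α ℓ μ v v') (k : OddGround α ℓ ν w w') (s t : ℝ) :
    ∫ x in (-ℓ)..ℓ, (s * v x + t * w x) ^ 2 =
      s ^ 2 * (∫ x in (-ℓ)..ℓ, v x ^ 2) + t ^ 2 * (∫ x in (-ℓ)..ℓ, w x ^ 2) := by
  have cv := continuous_of_hasDerivAt h.hasDeriv
  have cw := continuous_of_hasDerivAt k.hasDeriv
  have : ∀ x, (s * v x + t * w x) ^ 2 =
      s ^ 2 * v x ^ 2 + t ^ 2 * w x ^ 2 + 2 * s * t * (v x * w x) := fun x => by ring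
  simp_rw [this]
  rw [intervalIntegral.integral_add, intervalIntegral.integral_add,
    intervalIntegral.integral_const_mul, intervalIntegral.integral_const_mul,
    intervalIntegral.integral_const_mul, h.integral_mul_eq_zero hℓ k, mul_zero, add_zero]
  all_goals exact Continuous.intervalIntegrable (by fun_prop) _ _

/-! ### Logarithmic derivatives and monotonicity of the interval eigenvalues -/

theorem energy_eq {μ : ℝ} {v v' : ℝ → ℝ} (hv : ∀ x, HasDerivAt v (v' x) x)
    (hv' : ∀ x, HasDerivAt v' (-μ * v x) x) (x : ℝ) :
    v' x ^ 2 + μ * v x ^ 2 = v' 0 ^ 2 + μ * v 0 ^ 2 := by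
  have D : ∀ x, HasDerivAt (fun x => v' x ^ 2 + μ * v x ^ 2) 0 x := fun x => by
    refine (((hv' x).pow 2).add (((hv x).pow 2).const_mul μ)).congr_deriv ?_
    simp
    ring
  exact is_const_of_deriv_eq_zero (fun x => (D x).differentiableAt) (fun x => (D x).deriv) x 0

/-- By conservation of energy the numerator is constant, so its sign alone decides whether `v' / v`
increases or decreases. -/
theorem hasDerivAt_logDeriv {μ x : ℝ} {v v' : ℝ → ℝ} (hv : ∀ x, HasDerivAt v (v' x) x)
    (hv' : ∀ x, HasDerivAt v' (-μ * v x) x) (h : v x ≠ 0) :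
    HasDerivAt (fun x => v' x / v x) (-(v' 0 ^ 2 + μ * v 0 ^ 2) / v x ^ 2) x := by
  rw [← energy_eq hv hv' x]
  refine ((hv' x).div (hv x) h).congr_deriv ?_
  ring

theorem strictAntiOn_logDeriv {μ a b : ℝ} {v v' : ℝ → ℝ} (hv : ∀ x, HasDerivAt v (v' x) x)
    (hv' : ∀ x, HasDerivAt v' (-μ * v x) x) (h : ∀ x ∈ Icc a b, v x ≠ 0)
    (hE : 0 < v' 0 ^ 2 + μ * v 0 ^ 2) : StrictAntiOn (fun x => v' x / v x) (Icc a b) := by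
  refine strictAntiOn_of_hasDerivWithinAt_neg (convex_Icc _ _)
    (fun x hx => (hasDerivAt_logDeriv hv hv' (h x hx)).continuousAt.continuousWithinAt)
    (fun x hx => (hasDerivAt_logDeriv hv hv' (h x (interior_subset hx))).hasDerivWithinAt) ?_
  intro x hx
  have := h x (interior_subset hx)
  have : 0 < (v' 0 ^ 2 + μ * v 0 ^ 2) / v x ^ 2 := by positivity
  rw [neg_div]
  linarith

theorem strictMonoOn_logDeriv {μ a b : ℝ} {v v' : ℝ → ℝ} (hv : ∀ x, HasDerivAt v (v' x) x)
    (hv' : ∀ x, HasDerivAt v' (-μ * v x) x) (h : ∀ x ∈ Icc a b, v x ≠ 0)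
    (hE : v' 0 ^ 2 + μ * v 0 ^ 2 < 0) : StrictMonoOn (fun x => v' x / v x) (Icc a b) := by
  refine strictMonoOn_of_hasDerivWithinAt_pos (convex_Icc _ _)
    (fun x hx => (hasDerivAt_logDeriv hv hv' (h x hx)).continuousAt.continuousWithinAt)
    (fun x hx => (hasDerivAt_logDeriv hv hv' (h x (interior_subset hx))).hasDerivWithinAt) ?_
  intro x hx
  have := h x (interior_subset hx)
  have := sub_pos.2 hE
  have : 0 < (0 - (v' 0 ^ 2 + μ * v 0 ^ 2)) / v x ^ 2 := by positivity
  simpa using this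

theorem antitoneOn_wronskian {μ ν b : ℝ} {v v' w w' : ℝ → ℝ} (hv : ∀ x, HasDerivAt v (v' x) x)
    (hv' : ∀ x, HasDerivAt v' (-μ * v x) x) (hw : ∀ x, HasDerivAt w (w' x) x)
    (hw' : ∀ x, HasDerivAt w' (-ν * w x) x) (hμν : μ ≤ ν)
    (pv : ∀ x ∈ Ioc 0 b, 0 < v x) (pw : ∀ x ∈ Ioc 0 b, 0 < w x) :
    AntitoneOn (fun x => v x * w' x - v' x * w x) (Icc 0 b) := by
  have W := fun x => hasDerivAt_wronskian (hv x) (hv' x) (hw x) (hw' x)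
  refine antitoneOn_of_hasDerivWithinAt_nonpos (convex_Icc _ _)
    (continuous_of_hasDerivAt W).continuousOn (fun x _ => (W x).hasDerivWithinAt) ?_
  intro x hx
  rw [interior_Icc] at hx
  exact mul_nonpos_of_nonpos_of_nonneg (sub_nonpos.2 hμν)
    (mul_pos (pv x ⟨hx.1, hx.2.le⟩) (pw x ⟨hx.1, hx.2.le⟩)).le

theorem EvenGround.pos' {α ℓ μ : ℝ} {v v' : ℝ → ℝ} (h : EvenGround α ℓ μ v v') {x : ℝ}
    (hx : x ∈ Icc 0 ℓ) : 0 < v x :=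
  h.pos x ⟨by linarith [hx.1, hx.2], hx.2⟩

/-- If `μ ≤ ν`, the Wronskian forces `w' / w ≤ -α` at `ℓ`. But `w' / w` decreases strictly to `-α`
at `m`, for either sign of `α`, because the energy of an odd mode is `w'(0)² > 0`. -/
theorem OddGround.eigenvalue_lt {α ℓ m μ ν : ℝ} (hℓ : 0 < ℓ) (hm : ℓ < m) {v v' w w' : ℝ → ℝ}
    (h : OddGround α ℓ μ v v') (k : OddGround α m ν w w') : ν < μ := by
  by_contra! hc
  have A := antitoneOn_wronskian h.hasDeriv h.hasDeriv' k.hasDeriv k.hasDeriv' hc h.pos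
    (fun x hx => k.pos x ⟨hx.1, hx.2.trans hm.le⟩) (left_mem_Icc.2 hℓ.le) (right_mem_Icc.2 hℓ.le)
    hℓ.le
  simp only [h.zero, k.zero, h.right] at A
  have B := strictAntiOn_logDeriv (a := ℓ) (b := m) k.hasDeriv k.hasDeriv'
    (fun x hx => (k.pos x ⟨hℓ.trans_le hx.1, hx.2⟩).ne')
    (by simpa [k.zero] using pow_pos k.deriv_pos 2) (left_mem_Icc.2 hm.le)
    (right_mem_Icc.2 hm.le) hm
  have p1 := h.pos ℓ ⟨hℓ, le_rfl⟩
  have p2 := k.pos ℓ ⟨hℓ, hm.le⟩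
  have p3 := k.pos m ⟨hℓ.trans hm, le_rfl⟩
  simp only [k.right] at B
  rw [mul_div_cancel_right₀ _ p3.ne', lt_div_iff₀ p2] at B
  nlinarith

/-- Same argument as for odd modes; the energy is now `ν w(0)²`, positive because `ν > 0`. -/
theorem EvenGround.eigenvalue_lt_of_pos {α ℓ m μ ν : ℝ} (hν : 0 < ν) (hℓ : 0 < ℓ) (hm : ℓ < m)
    {v v' w w' : ℝ → ℝ} (h : EvenGround α ℓ μ v v') (k : EvenGround α m ν w w') : ν < μ := by
  by_contra! hc
  have A := antitoneOn_wronskian (b := ℓ) h.hasDeriv h.hasDeriv' k.hasDeriv k.hasDeriv' hc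
    (fun x hx => h.pos' ⟨hx.1.le, hx.2⟩)
    (fun x hx => k.pos' ⟨hx.1.le, hx.2.trans hm.le⟩) (left_mem_Icc.2 hℓ.le)
    (right_mem_Icc.2 hℓ.le) hℓ.le
  simp only [h.deriv_zero, k.deriv_zero, h.right] at A
  have p0 := k.pos' (x := 0) ⟨le_rfl, by linarith⟩
  have B := strictAntiOn_logDeriv (a := ℓ) (b := m) k.hasDeriv k.hasDeriv'
    (fun x hx => (k.pos' ⟨hℓ.le.trans hx.1, hx.2⟩).ne')
    (by rw [k.deriv_zero]; positivity) (left_mem_Icc.2 hm.le)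
    (right_mem_Icc.2 hm.le) hm
  have p1 := h.pos' (x := ℓ) ⟨hℓ.le, le_rfl⟩
  have p2 := k.pos' (x := ℓ) ⟨hℓ.le, hm.le⟩
  have p3 := k.pos' (x := m) ⟨by linarith, le_rfl⟩
  simp only [k.right] at B
  rw [mul_div_cancel_right₀ _ p3.ne', lt_div_iff₀ p2] at B
  nlinarith

/-- Here the energy `ν w(0)²` is negative, so `w' / w` increases towards `-α` and every comparison
is reversed. -/
theorem EvenGround.lt_eigenvalue_of_neg {α ℓ m μ ν : ℝ} (hν : ν < 0) (hℓ : 0 < ℓ) (hm : ℓ < m)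
    {v v' w w' : ℝ → ℝ} (h : EvenGround α ℓ μ v v') (k : EvenGround α m ν w w') : μ < ν := by
  by_contra! hc
  have A := antitoneOn_wronskian (b := ℓ) k.hasDeriv k.hasDeriv' h.hasDeriv h.hasDeriv' hc
    (fun x hx => k.pos' ⟨hx.1.le, hx.2.trans hm.le⟩)
    (fun x hx => h.pos' ⟨hx.1.le, hx.2⟩) (left_mem_Icc.2 hℓ.le)
    (right_mem_Icc.2 hℓ.le) hℓ.le
  simp only [h.deriv_zero, k.deriv_zero, h.right] at A
  have p0 := k.pos' (x := 0) ⟨le_rfl, by linarith⟩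
  have B := strictMonoOn_logDeriv (a := ℓ) (b := m) k.hasDeriv k.hasDeriv'
    (fun x hx => (k.pos' ⟨hℓ.le.trans hx.1, hx.2⟩).ne')
    (by rw [k.deriv_zero]; nlinarith [pow_pos p0 2]) (left_mem_Icc.2 hm.le)
    (right_mem_Icc.2 hm.le) hm
  have p1 := h.pos' (x := ℓ) ⟨hℓ.le, le_rfl⟩
  have p2 := k.pos' (x := ℓ) ⟨hℓ.le, hm.le⟩
  have p3 := k.pos' (x := m) ⟨by linarith, le_rfl⟩
  simp only [k.right] at B
  rw [mul_div_cancel_right₀ _ p3.ne', div_lt_iff₀ p2] at B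
  nlinarith

/-- For positive Robin parameters the logarithmic derivative of the ground state decreases in
absolute value when the interval grows. -/
theorem EvenGround.sq_logDeriv_le {α ℓ m μ ν : ℝ} (hν : 0 < ν) (hμν : ν ≤ μ) (hm : ℓ ≤ m)
    {v v' w w' : ℝ → ℝ} (h : EvenGround α ℓ μ v v') (k : EvenGround α m ν w w') {x : ℝ}
    (hx : x ∈ Icc 0 ℓ) : (w' x / w x) ^ 2 ≤ (v' x / v x) ^ 2 := by
  have A := antitoneOn_wronskian (b := ℓ) k.hasDeriv k.hasDeriv' h.hasDeriv h.hasDeriv' hμν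
    (fun x hx => k.pos' ⟨hx.1.le, hx.2.trans hm⟩)
    (fun x hx => h.pos' ⟨hx.1.le, hx.2⟩) (left_mem_Icc.2 (hx.1.trans hx.2)) hx hx.1
  simp only [h.deriv_zero, k.deriv_zero] at A
  have p0 := k.pos' (x := 0) ⟨le_rfl, by linarith [hx.1, hx.2]⟩
  have B := (strictAntiOn_logDeriv (a := 0) (b := m) k.hasDeriv k.hasDeriv'
    (fun x hx => (k.pos' hx).ne')
    (by rw [k.deriv_zero]; positivity)).antitoneOn (left_mem_Icc.2 (by linarith [hx.1, hx.2]))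
    ⟨hx.1, hx.2.trans hm⟩ hx.1
  simp only [k.deriv_zero, zero_div] at B
  have p1 := h.pos' hx
  have p2 := k.pos' ⟨hx.1, hx.2.trans hm⟩
  -- Both logarithmic derivatives are nonpositive, `v' / v ≤ w' / w ≤ 0`, so their squares compare
  -- the other way.
  have C : v' x / v x ≤ w' x / w x := by
    rw [div_le_div_iff₀ p1 p2]
    linarith
  nlinarith

/-! ### Monotonicity of the spectral gap -/

/-- The spectral gap decreases strictly when the interval grows, for positive Robin parameters:
the ground-state transform makes it the Dirichlet ground-state energy of a Schrödinger operator
whose potential decreases with the interval's length. -/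
theorem gap_lt_of_pos {α ℓ m μ ν M N : ℝ} (hM : 0 < M) (hℓ : 0 < ℓ) (hm : ℓ < m)
    {v v' w w' V V' W W' : ℝ → ℝ}
    (h : EvenGround α ℓ μ v v') (k : OddGround α ℓ ν w w')
    (H : EvenGround α m M V V') (K : OddGround α m N W W') : N - M < ν - μ := by
  by_contra! hc
  have hMμ := h.eigenvalue_lt_of_pos hM hℓ hm H
  have hμν := h.lt_of_oddGround hℓ k
  have hMN := H.lt_of_oddGround (hℓ.trans hm) K
  -- positivity of the Wronskians
  have qpos : ∀ {α ℓ μ ν : ℝ} {v v' w w' : ℝ → ℝ}, EvenGround α ℓ μ v v' → OddGround α ℓ ν w w' →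
      μ < ν → ∀ x ∈ Icc 0 ℓ, 0 ≤ v x * w' x - v' x * w x := by
    intro α ℓ μ ν v v' w w' h k hlt x hx
    have := antitoneOn_wronskian (b := ℓ) h.hasDeriv h.hasDeriv' k.hasDeriv k.hasDeriv' hlt.le
      (fun x hx => h.pos' ⟨hx.1.le, hx.2⟩) k.pos hx (right_mem_Icc.2 (hx.1.trans hx.2)) hx.2
    simp only [h.right, k.right] at this
    linarith
  -- On the longer interval the Wronskian decreases strictly and is still nonnegative at `m`, hence
  -- positive at the interior point `ℓ`.
  have qpos' : 0 < V ℓ * W' ℓ - V' ℓ * W ℓ := by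
    refine (qpos H K hMN m ⟨by linarith, le_rfl⟩).trans_lt ?_
    have D := fun x => hasDerivAt_wronskian (H.hasDeriv x) (H.hasDeriv' x) (K.hasDeriv x)
      (K.hasDeriv' x)
    refine strictAntiOn_of_hasDerivWithinAt_neg (convex_Icc 0 m)
      (continuous_of_hasDerivAt D).continuousOn (fun x _ => (D x).hasDerivWithinAt) ?_
      ⟨hℓ.le, hm.le⟩ ⟨by linarith, le_rfl⟩ hm
    intro x hx
    rw [interior_Icc] at hx
    exact mul_neg_of_neg_of_pos (sub_neg.2 hMN)
      (mul_pos (H.pos' ⟨hx.1.le, hx.2.le⟩) (K.pos x ⟨hx.1, hx.2.le⟩))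
  have Dp : ∀ {μ ν x : ℝ} {v v' w w' : ℝ → ℝ}, (∀ x, HasDerivAt v (v' x) x) →
      (∀ x, HasDerivAt v' (-μ * v x) x) → (∀ x, HasDerivAt w (w' x) x) →
      (∀ x, HasDerivAt w' (-ν * w x) x) → v x ≠ 0 →
      HasDerivAt (fun x => w' x - v' x / v x * w x)
        (-(ν - μ) * w x - v' x / v x * (w' x - v' x / v x * w x)) x ∧
      HasDerivAt (fun x => v' x / v x) (-μ - (v' x / v x) ^ 2) x := by
    intro μ ν x v v' w w' hv hv' hw hw' h0
    have hr : HasDerivAt (fun x => v' x / v x) (-μ - (v' x / v x) ^ 2) x := by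
      refine ((hv' x).div (hv x) h0).congr_deriv ?_
      field_simp
    refine ⟨((hw' x).sub (hr.mul (hw x))).congr_deriv ?_, hr⟩
    ring
  -- `p = v (w / v)'` satisfies `-p'' + (2 (v' / v)² + μ) p = (ν - μ) p` and `p ℓ = 0`; `P` is its
  -- counterpart on the longer interval, still positive at `ℓ`.
  set p := fun x => w' x - v' x / v x * w x with hp
  set P := fun x => W' x - V' x / V x * W x with hP
  have ppos : ∀ x ∈ Icc 0 ℓ, 0 ≤ p x := fun x hx => by
    have h0 := h.pos' hx
    have : p x = (v x * w' x - v' x * w x) / v x := by simp only [hp]; field_simp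
    rw [this]
    exact div_nonneg (qpos h k hμν x hx) h0.le
  have Ppos : ∀ x ∈ Icc 0 ℓ, 0 ≤ P x := fun x hx => by
    have h0 := H.pos' ⟨hx.1, hx.2.trans hm.le⟩
    have : P x = (V x * W' x - V' x * W x) / V x := by simp only [hP]; field_simp
    rw [this]
    exact div_nonneg (qpos H K hMN x ⟨hx.1, hx.2.trans hm.le⟩) h0.le
  have Ppos' : 0 < P ℓ := by
    have h0 := H.pos' ⟨hℓ.le, hm.le⟩
    have : P ℓ = (V ℓ * W' ℓ - V' ℓ * W ℓ) / V ℓ := by simp only [hP]; field_simp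
    rw [this]
    exact div_pos qpos' h0
  -- The function is the Wronskian `p P' - p' P`, with `p'` and `P'` eliminated by the first-order
  -- equations in `Dp`. Its derivative is `p P` times the difference of potentials plus the
  -- difference of gaps.
  have D : ∀ x ∈ Icc 0 ℓ, HasDerivAt (fun x => p x * P x * (v' x / v x - V' x / V x)
      + (ν - μ) * (w x * P x) - (N - M) * (p x * W x))
      (p x * P x * (2 * ((V' x / V x) ^ 2 - (v' x / v x) ^ 2) + (M - μ)
        + ((ν - μ) - (N - M)))) x := by
    intro x hx
    obtain ⟨d1, d2⟩ := Dp h.hasDeriv h.hasDeriv' k.hasDeriv k.hasDeriv' (h.pos' hx).ne'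
    obtain ⟨d3, d4⟩ := Dp H.hasDeriv H.hasDeriv' K.hasDeriv K.hasDeriv'
      (H.pos' ⟨hx.1, hx.2.trans hm.le⟩).ne'
    refine ((((d1.mul d3).mul (d2.sub d4)).add
      (((k.hasDeriv x).mul d3).const_mul (ν - μ))).sub
      ((d1.mul (K.hasDeriv x)).const_mul (N - M))).congr_deriv ?_
    have e1 : w' x = p x + v' x / v x * w x := by simp only [hp]; ring
    have e2 : W' x = P x + V' x / V x * W x := by simp only [hP]; ring
    simp only [Pi.mul_apply, Pi.sub_apply]
    rw [e1, e2]
    ring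
  have A : AntitoneOn (fun x => p x * P x * (v' x / v x - V' x / V x)
      + (ν - μ) * (w x * P x) - (N - M) * (p x * W x)) (Icc 0 ℓ) := by
    refine antitoneOn_of_hasDerivWithinAt_nonpos (convex_Icc _ _)
      (fun x hx => (D x hx).continuousAt.continuousWithinAt)
      (fun x hx => (D x (interior_subset hx)).hasDerivWithinAt) ?_
    intro x hx
    have hx := interior_subset hx
    have := h.sq_logDeriv_le hM hMμ.le hm.le H hx
    exact mul_nonpos_of_nonneg_of_nonpos (mul_nonneg (ppos x hx) (Ppos x hx)) (by linarith)
  -- The Wronskian vanishes at `0` and equals `(ν - μ) w(ℓ) P(ℓ) > 0` at `ℓ`, so it cannot be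
  -- nonincreasing.
  have := A (left_mem_Icc.2 hℓ.le) (right_mem_Icc.2 hℓ.le) hℓ.le
  have pℓ : p ℓ = 0 := by
    have h0 := (h.pos' ⟨hℓ.le, le_rfl⟩).ne'
    simp only [hp, h.right, k.right]
    field_simp
    ring
  norm_num [pℓ, k.zero, K.zero, h.deriv_zero, H.deriv_zero] at this
  have pos := mul_pos (sub_pos.2 hμν) (mul_pos (k.pos ℓ ⟨hℓ, le_rfl⟩) Ppos')
  linarith

/-! ### Explicit modes on an interval and their existence -/

theorem evenGround_cos {α ℓ k : ℝ} (hk : 0 < k) (h : k * ℓ < Real.pi / 2)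
    (e : k * Real.sin (k * ℓ) = α * Real.cos (k * ℓ)) :
    EvenGround α ℓ (k ^ 2) (fun x => Real.cos (k * x)) (fun x => -k * Real.sin (k * x)) where
  hasDeriv x := by
    refine (((hasDerivAt_id x).const_mul k).cos).congr_deriv ?_
    simp; ring
  hasDeriv' x := by
    refine ((((hasDerivAt_id x).const_mul k).sin).const_mul (-k)).congr_deriv ?_
    simp; ring
  pos x hx := Real.cos_pos_of_mem_Ioo ⟨by nlinarith [hx.1], by nlinarith [hx.2]⟩
  deriv_zero := by simp
  right := by linarith
  left := by simp; linarith

theorem oddGround_sin {α ℓ k : ℝ} (hk : 0 < k) (h : k * ℓ < Real.pi)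
    (e : k * Real.cos (k * ℓ) = -α * Real.sin (k * ℓ)) :
    OddGround α ℓ (k ^ 2) (fun x => Real.sin (k * x)) (fun x => k * Real.cos (k * x)) where
  hasDeriv x := by
    refine (((hasDerivAt_id x).const_mul k).sin).congr_deriv ?_
    simp; ring
  hasDeriv' x := by
    refine ((((hasDerivAt_id x).const_mul k).cos).const_mul k).congr_deriv ?_
    simp; ring
  zero := by simp
  deriv_pos := by simpa
  pos x hx := Real.sin_pos_of_pos_of_lt_pi (mul_pos hk hx.1) (by nlinarith [hx.2])
  right := e
  left := by simp; linarith

theorem evenGround_cosh {α ℓ k : ℝ} (e : k * Real.sinh (k * ℓ) = -α * Real.cosh (k * ℓ)) :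
    EvenGround α ℓ (-k ^ 2) (fun x => Real.cosh (k * x)) (fun x => k * Real.sinh (k * x)) where
  hasDeriv x := by
    refine (((hasDerivAt_id x).const_mul k).cosh).congr_deriv ?_
    simp; ring
  hasDeriv' x := by
    refine ((((hasDerivAt_id x).const_mul k).sinh).const_mul k).congr_deriv ?_
    simp; ring
  pos x hx := Real.cosh_pos _
  deriv_zero := by simp
  right := e
  left := by simp; linarith

theorem oddGround_sinh {α ℓ k : ℝ} (hk : 0 < k)
    (e : k * Real.cosh (k * ℓ) = -α * Real.sinh (k * ℓ)) :
    OddGround α ℓ (-k ^ 2) (fun x => Real.sinh (k * x)) (fun x => k * Real.cosh (k * x)) where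
  hasDeriv x := by
    refine (((hasDerivAt_id x).const_mul k).sinh).congr_deriv ?_
    simp; ring
  hasDeriv' x := by
    refine ((((hasDerivAt_id x).const_mul k).cosh).const_mul k).congr_deriv ?_
    simp; ring
  zero := by simp
  deriv_pos := by simpa
  pos x hx := Real.sinh_pos_iff.2 (mul_pos hk hx.1)
  right := e
  left := by simp; linarith

theorem oddGround_id {α ℓ : ℝ} (e : -α * ℓ = 1) :
    OddGround α ℓ 0 (fun x => x) (fun _ => 1) where
  hasDeriv x := hasDerivAt_id x
  hasDeriv' x := by simpa using hasDerivAt_const x (1 : ℝ)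
  zero := rfl
  deriv_pos := one_pos
  pos x hx := hx.1
  right := e.symm
  left := by linarith

theorem exists_evenGround {α ℓ : ℝ} (hα : α ≠ 0) (hℓ : 0 < ℓ) :
    ∃ μ v v', 0 < α * μ ∧ EvenGround α ℓ μ v v' := by
  rcases hα.lt_or_gt with hα | hα
  · set c := -α * ℓ with hc
    have hc0 : 0 < c := by rw [hc]; nlinarith
    -- At `c + 1` the function equals `sinh (c + 1) - c (cosh (c + 1) - sinh (c + 1))`, which
    -- exceeds `(c + 1) - c`.
    obtain ⟨x, hx, hx'⟩ := intermediate_value_Ioo (a := 0) (b := c + 1) (by linarith)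
      (f := fun x => x * Real.sinh x - c * Real.cosh x) (by fun_prop)
      (show (0 : ℝ) ∈ _ from ⟨by simpa, by
        have h1 := Real.self_lt_sinh_iff.2 (show 0 < c + 1 by linarith)
        have h2 : Real.cosh (c + 1) - Real.sinh (c + 1) ≤ 1 := by
          rw [Real.cosh_sub_sinh, Real.exp_le_one_iff]; linarith
        nlinarith⟩)
    refine ⟨_, _, _, ?_, evenGround_cosh (k := x / ℓ) ?_⟩
    · have : 0 < (x / ℓ) ^ 2 := pow_pos (div_pos hx.1 hℓ) 2
      nlinarith
    · rw [div_mul_cancel₀ _ hℓ.ne']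
      simp only [hc] at hx'
      field_simp
      linarith
  · set c := α * ℓ with hc
    have hc0 : 0 < c := by positivity
    have hpi := Real.pi_pos
    obtain ⟨x, hx, hx'⟩ := intermediate_value_Ioo (a := 0) (b := Real.pi / 2) (by positivity)
      (f := fun x => x * Real.sin x - c * Real.cos x) (by fun_prop)
      (show (0 : ℝ) ∈ _ from ⟨by simpa, by simpa⟩)
    refine ⟨_, _, _, ?_, evenGround_cos (k := x / ℓ) (div_pos hx.1 hℓ) ?_ ?_⟩
    · have := div_pos hx.1 hℓ
      positivity
    · rw [div_mul_cancel₀ _ hℓ.ne']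
      exact hx.2
    · rw [div_mul_cancel₀ _ hℓ.ne']
      simp only [hc] at hx'
      field_simp
      linarith

theorem exists_oddGround {α ℓ : ℝ} (hα : α ≠ 0) (hℓ : 0 < ℓ) :
    ∃ μ v v', OddGround α ℓ μ v v' := by
  have hpi := Real.pi_pos
  rcases hα.lt_or_gt with hα | hα
  · set c := -α * ℓ with hc
    have hc0 : 0 < c := by rw [hc]; nlinarith
    -- The odd eigenvalue is positive, zero or negative according as `c < 1`, `c = 1` or `c > 1`.
    rcases lt_trichotomy c 1 with h1 | h1 | h1
    -- Writing `sin x / x` as `sinc` removes the trivial root at `0`: the function there is `1 - c >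
    -- 0`.
    · obtain ⟨x, hx, hx'⟩ := intermediate_value_Ioo' (a := 0) (b := Real.pi / 2) (by positivity)
        (f := fun x => Real.cos x - c * Real.sinc x)
        (Real.continuous_cos.sub (continuous_const.mul Real.continuous_sinc)).continuousOn
        (show (0 : ℝ) ∈ _ from ⟨by
          have : Real.pi / 2 ≠ 0 := by positivity
          simp [Real.sinc_of_ne_zero this]
          positivity, by simpa⟩)
      simp only [Real.sinc_of_ne_zero hx.1.ne'] at hx'
      have hx0 := hx.1
      refine ⟨_, _, _, oddGround_sin (k := x / ℓ) (div_pos hx.1 hℓ) ?_ ?_⟩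
      · rw [div_mul_cancel₀ _ hℓ.ne']
        linarith [hx.2]
      · rw [div_mul_cancel₀ _ hℓ.ne']
        field_simp at hx'
        simp only [hc] at hx'
        field_simp
        linarith
    · exact ⟨_, _, _, oddGround_id h1⟩
    -- The limit `1 - c < 0` provides a left endpoint `ε > 0` with a strict sign, away from the
    -- trivial root at `0`.
    · have hT : Tendsto (fun x => Real.cosh x - c * (Real.sinh x / x)) (𝓝[>] 0)
          (𝓝 (1 - c * 1)) := by
        refine Tendsto.sub ?_ (Tendsto.const_mul c ?_)
        · simpa using (Real.continuous_cosh.tendsto 0).mono_left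
            (nhdsWithin_le_nhds (s := Ioi 0))
        · have := (hasDerivAt_iff_tendsto_slope.1 (Real.hasDerivAt_sinh 0)).mono_left
            (nhdsWithin_mono _ fun x (hx : (0:ℝ) < x) => hx.ne')
          rw [Real.cosh_zero] at this
          refine this.congr fun x => ?_
          simp [slope_def_field]
      obtain ⟨ε, hε, hε'⟩ := ((hT.eventually_lt_const (u := 0) (by linarith)).and
        (Ioo_mem_nhdsGT hc0)).exists
      obtain ⟨x, hx, hx'⟩ := intermediate_value_Ioo (a := ε) (b := c) hε'.2.le
        (f := fun x => x * Real.cosh x - c * Real.sinh x) (by fun_prop)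
        (show (0 : ℝ) ∈ _ from ⟨by
          have := mul_neg_of_pos_of_neg hε'.1 hε
          have h0 := hε'.1.ne'
          have e : ε * (Real.cosh ε - c * (Real.sinh ε / ε)) =
            ε * Real.cosh ε - c * Real.sinh ε := by field_simp
          rwa [e] at this, by
          have := mul_pos hc0 (sub_pos.2 (Real.sinh_lt_cosh c))
          linarith⟩)
      have hx0 := hε'.1.trans hx.1
      refine ⟨_, _, _, oddGround_sinh (k := x / ℓ) (div_pos hx0 hℓ) ?_⟩
      rw [div_mul_cancel₀ _ hℓ.ne']
      simp only [hc] at hx'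
      field_simp
      linarith
  · set c := α * ℓ with hc
    have hc0 : 0 < c := by positivity
    obtain ⟨x, hx, hx'⟩ := intermediate_value_Ioo' (a := Real.pi / 2) (b := Real.pi)
      (by linarith) (f := fun x => x * Real.cos x + c * Real.sin x) (by fun_prop)
      (show (0 : ℝ) ∈ _ from ⟨by simpa, by simpa⟩)
    have hx0 : 0 < x := by linarith [hx.1]
    refine ⟨_, _, _, oddGround_sin (k := x / ℓ) (div_pos hx0 hℓ) ?_ ?_⟩
    · rw [div_mul_cancel₀ _ hℓ.ne']
      linarith [hx.2]
    · rw [div_mul_cancel₀ _ hℓ.ne']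
      simp only [hc] at hx'
      field_simp
      linarith

theorem gap_lt {α ℓ m μ ν M N : ℝ} (hM : 0 < α * M) (hℓ : 0 < ℓ) (hm : ℓ < m)
    {v v' w w' V V' W W' : ℝ → ℝ}
    (h : EvenGround α ℓ μ v v') (k : OddGround α ℓ ν w w')
    (H : EvenGround α m M V V') (K : OddGround α m N W W') : N - M < ν - μ := by
  rcases pos_and_pos_or_neg_and_neg_of_mul_pos hM with ⟨_, hM⟩ | ⟨_, hM⟩
  · exact gap_lt_of_pos hM hℓ hm h k H K
  · have := h.lt_eigenvalue_of_neg hM hℓ hm H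
    have := k.eigenvalue_lt hℓ hm K
    linarith

theorem EvenGround.eigenvalue_ne {α ℓ m μ ν : ℝ} (hν : 0 < α * ν) (hℓ : 0 < ℓ)
    (hm : ℓ < m) {v v' w w' : ℝ → ℝ} (h : EvenGround α ℓ μ v v') (k : EvenGround α m ν w w') :
    μ ≠ ν := by
  rcases pos_and_pos_or_neg_and_neg_of_mul_pos hν with ⟨_, hν⟩ | ⟨_, hν⟩
  · exact (h.eigenvalue_lt_of_pos hν hℓ hm k).ne'
  · exact (h.lt_eigenvalue_of_neg hν hℓ hm k).ne

/-! ### Smooth functions as elements of the Sobolev space -/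

/-- Bounded open plane sets with boundary of finite length. -/
structure IsTameDomain (Ω : Set Plane) : Prop where
  isOpen : IsOpen Ω
  isBounded : Bornology.IsBounded Ω
  isFiniteMeasure : IsFiniteMeasure (boundaryMeasure Ω)

theorem Continuous.memLp_of_ae_mem_isCompact {E : Type*} [NormedAddCommGroup E]
    [SecondCountableTopology E] {μ : Measure Plane} [IsFiniteMeasure μ] {K : Set Plane}
    (hK : IsCompact K) (hμ : ∀ᵐ x ∂μ, x ∈ K) {f : Plane → E} (hf : Continuous f) :
    MemLp f 2 μ := by
  borelize E
  obtain ⟨C, hC⟩ := hK.exists_bound_of_continuousOn hf.continuousOn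
  exact MemLp.of_bound hf.aestronglyMeasurable C (hμ.mono fun x hx => hC x hx)

namespace IsTameDomain

variable {Ω : Set Plane} {E : Type*} [NormedAddCommGroup E] [SecondCountableTopology E]

theorem isFiniteMeasure_restrict (h : IsTameDomain Ω) : IsFiniteMeasure (volume.restrict Ω) :=
  ⟨by simpa using h.isBounded.measure_lt_top⟩

theorem memLp (h : IsTameDomain Ω) {f : Plane → E} (hf : Continuous f) :
    MemLp f 2 (volume.restrict Ω) := by
  have := h.isFiniteMeasure_restrict
  exact hf.memLp_of_ae_mem_isCompact h.isBounded.isCompact_closure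
    ((ae_restrict_mem h.isOpen.measurableSet).mono fun x hx => subset_closure hx)

theorem memLp_boundary (h : IsTameDomain Ω) {f : Plane → E} (hf : Continuous f) :
    MemLp f 2 (boundaryMeasure Ω) := by
  have := h.isFiniteMeasure
  exact hf.memLp_of_ae_mem_isCompact (μ := boundaryMeasure Ω) h.isBounded.isCompact_closure
    ((ae_restrict_mem isClosed_frontier.measurableSet).mono fun x hx => frontier_subset_closure hx)

end IsTameDomain

theorem ContDiff.continuous_gradient {φ : Plane → ℝ} (hφ : ContDiff ℝ ∞ φ) :
    Continuous (gradient φ) :=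
  (LinearIsometryEquiv.continuous _).comp (hφ.continuous_fderiv (by simp))

/-- A smooth function as an element of `H¹(Ω)`. -/
noncomputable def smoothJet {Ω : Set Plane} (h : IsTameDomain Ω) {φ : Plane → ℝ}
    (hφ : ContDiff ℝ ∞ φ) : L2Triple Ω :=
  ((h.memLp hφ.continuous).toLp φ, (h.memLp hφ.continuous_gradient).toLp (gradient φ),
    (h.memLp_boundary hφ.continuous).toLp φ)

theorem sq_norm_Lp {X E : Type*} [MeasurableSpace X] {μ : Measure X} [NormedAddCommGroup E]
    [InnerProductSpace ℝ E] (f : Lp E 2 μ) : ‖f‖ ^ 2 = ∫ x, ‖f x‖ ^ 2 ∂μ := by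
  rw [← real_inner_self_eq_norm_sq, L2.inner_def]
  simp_rw [real_inner_self_eq_norm_sq]

theorem sq_norm_toLp {X E : Type*} [MeasurableSpace X] {μ : Measure X} [NormedAddCommGroup E]
    [InnerProductSpace ℝ E] {f : X → E} (hf : MemLp f 2 μ) :
    ‖hf.toLp f‖ ^ 2 = ∫ x, ‖f x‖ ^ 2 ∂μ := by
  rw [sq_norm_Lp]
  exact integral_congr_ae (hf.coeFn_toLp.mono fun x hx => by simp only [hx])

theorem inner_toLp {X : Type*} [MeasurableSpace X] {μ : Measure X} {f g : X → ℝ}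
    (hf : MemLp f 2 μ) (hg : MemLp g 2 μ) :
    inner ℝ (hf.toLp f) (hg.toLp g) = ∫ x, f x * g x ∂μ := by
  rw [L2.inner_def]
  refine integral_congr_ae ?_
  filter_upwards [hf.coeFn_toLp, hg.coeFn_toLp] with x h1 h2
  simp [h1, h2, mul_comm]

/-- The Robin energy of a smooth function. -/
noncomputable def smoothEnergy (Ω : Set Plane) (α : ℝ) (φ : Plane → ℝ) : ℝ :=
  (∫ x in Ω, ‖gradient φ x‖ ^ 2) + α * ∫ x, φ x ^ 2 ∂(boundaryMeasure Ω)

/-- The Robin energy on `H¹(Ω)`. -/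
noncomputable def sobolevEnergy {Ω : Set Plane} (α : ℝ) (p : L2Triple Ω) : ℝ :=
  ‖p.2.1‖ ^ 2 + α * ‖p.2.2‖ ^ 2

theorem robinRayleigh_eq {Ω : Set Plane} (α : ℝ) (p : L2Triple Ω) :
    robinRayleigh Ω α p = sobolevEnergy α p / ‖p.1‖ ^ 2 := by
  rw [robinRayleigh, sobolevEnergy, sq_norm_Lp, sq_norm_Lp, sq_norm_Lp]
  simp

section jet

variable {Ω : Set Plane} (h : IsTameDomain Ω) {φ ψ : Plane → ℝ}

theorem sq_norm_smoothJet_fst (hφ : ContDiff ℝ ∞ φ) :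
    ‖(smoothJet h hφ).1‖ ^ 2 = ∫ x in Ω, φ x ^ 2 := by
  rw [smoothJet, sq_norm_toLp]
  simp

theorem sobolevEnergy_smoothJet (α : ℝ) (hφ : ContDiff ℝ ∞ φ) :
    sobolevEnergy α (smoothJet h hφ) = smoothEnergy Ω α φ := by
  rw [sobolevEnergy, smoothJet, sq_norm_toLp, sq_norm_toLp, smoothEnergy]
  simp

theorem smoothJet_comb (hφ : ContDiff ℝ ∞ φ) (hψ : ContDiff ℝ ∞ ψ) (s t : ℝ)
    (hst : ContDiff ℝ ∞ fun x => s * φ x + t * ψ x) :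
    s • smoothJet h hφ + t • smoothJet h hψ = smoothJet h hst := by
  have G : gradient (fun x => s * φ x + t * ψ x) = s • gradient φ + t • gradient ψ := by
    funext x
    have d1 : DifferentiableAt ℝ φ x := hφ.differentiable (by simp) x
    have d2 : DifferentiableAt ℝ ψ x := hψ.differentiable (by simp) x
    simp only [gradient, Pi.add_apply, Pi.smul_apply]
    rw [fderiv_fun_add (d1.const_mul s) (d2.const_mul t), fderiv_const_mul d1, fderiv_const_mul d2,
      map_add, map_smul, map_smul]
  refine Prod.ext ?_ (Prod.ext ?_ ?_)
  · simp only [smoothJet, Prod.fst_add, Prod.smul_fst]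
    rw [← MemLp.toLp_const_smul, ← MemLp.toLp_const_smul, ← MemLp.toLp_add]
    rfl
  · simp only [smoothJet, Prod.snd_add, Prod.smul_snd, Prod.fst_add, Prod.smul_fst, G]
    rw [← MemLp.toLp_const_smul, ← MemLp.toLp_const_smul, ← MemLp.toLp_add]
  · simp only [smoothJet, Prod.snd_add, Prod.smul_snd]
    rw [← MemLp.toLp_const_smul, ← MemLp.toLp_const_smul, ← MemLp.toLp_add]
    rfl

/-- Integration by parts in each direction `v`. Only products with the test function are integrated,
so `φ` itself needs no decay. -/
theorem isWeakGradient_of_contDiff (hφ : ContDiff ℝ ∞ φ) :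
    IsWeakGradient Ω φ (gradient φ) := by
  intro ψ hψ hc hs
  have hψ0 : ∀ x, x ∉ Ω → ψ x = 0 := fun x hx => image_eq_zero_of_notMem_tsupport fun h => hx (hs h)
  have hψ1 : ∀ x, x ∉ tsupport ψ → gradient ψ x = 0 := fun x hx => by
    have : fderiv ℝ ψ x = 0 := by
      by_contra h0
      exact hx (support_fderiv_subset ℝ h0)
    simp [gradient, this]
  rw [setIntegral_eq_integral_of_forall_compl_eq_zero fun x hx => by
      rw [hψ1 x fun h => hx (hs h), smul_zero],
    setIntegral_eq_integral_of_forall_compl_eq_zero fun x hx => by rw [hψ0 x hx, zero_smul]]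
  have c1 : HasCompactSupport fun x => φ x • gradient ψ x :=
    HasCompactSupport.intro hc fun x hx => by rw [hψ1 x hx, smul_zero]
  have c2 : HasCompactSupport fun x => ψ x • gradient φ x :=
    HasCompactSupport.intro hc fun x hx => by
      rw [image_eq_zero_of_notMem_tsupport hx, zero_smul]
  have i1 : Integrable fun x => φ x • gradient ψ x :=
    (hφ.continuous.smul hψ.continuous_gradient).integrable_of_hasCompactSupport c1
  have i2 : Integrable fun x => ψ x • gradient φ x :=
    (hψ.continuous.smul hφ.continuous_gradient).integrable_of_hasCompactSupport c2
  refine ext_inner_left ℝ fun v => ?_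
  rw [inner_neg_right, ← integral_inner i1, ← integral_inner i2]
  have e1 : ∀ x, inner ℝ v (φ x • gradient ψ x) = φ x * fderiv ℝ ψ x v := fun x => by
    rw [real_inner_smul_right, inner_gradient_right]; simp
  have e2 : ∀ x, inner ℝ v (ψ x • gradient φ x) = fderiv ℝ φ x v * ψ x := fun x => by
    rw [real_inner_smul_right, inner_gradient_right]; simp [mul_comm]
  have j1 := i1.const_inner v (𝕜 := ℝ)
  have j2 := i2.const_inner v (𝕜 := ℝ)
  simp_rw [e1] at j1 ⊢
  simp_rw [e2] at j2 ⊢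
  refine integral_mul_fderiv_eq_neg_fderiv_mul_of_integrable j2 j1 ?_
    (fun x _ => hφ.differentiable (by simp) x) (fun x _ => hψ.differentiable (by simp) x)
  exact (hφ.continuous.mul hψ.continuous).integrable_of_hasCompactSupport hc.mul_left

theorem smoothJet_mem_sobolevH1 (hφ : ContDiff ℝ ∞ φ) : smoothJet h hφ ∈ sobolevH1 Ω := by
  have e1 := (h.memLp hφ.continuous).coeFn_toLp
  have e2 := (h.memLp hφ.continuous_gradient).coeFn_toLp
  have e3 := (h.memLp_boundary hφ.continuous).coeFn_toLp
  refine ⟨fun ψ hψ hc hs => ?_, fun _ => φ, fun _ => hφ, ?_, ?_, ?_⟩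
  · refine Eq.trans ?_ ((isWeakGradient_of_contDiff hφ ψ hψ hc hs).trans ?_)
    · exact integral_congr_ae (e1.mono fun x hx => by simp only [smoothJet, hx])
    · refine congrArg _ (integral_congr_ae (e2.mono fun x hx => ?_))
      simp only [smoothJet, hx]
  · have : (fun x => φ x - (smoothJet h hφ).1 x) =ᵐ[volume.restrict Ω] 0 :=
      e1.mono fun x hx => by simp [smoothJet, hx]
    simp [eLpNorm_congr_ae this]
  · have : (fun x => gradient φ x - (smoothJet h hφ).2.1 x) =ᵐ[volume.restrict Ω] 0 :=
      e2.mono fun x hx => by simp [smoothJet, hx]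
    simp [eLpNorm_congr_ae this]
  · have : (fun x => φ x - (smoothJet h hφ).2.2 x) =ᵐ[boundaryMeasure Ω] 0 :=
      e3.mono fun x hx => by simp [smoothJet, hx]
    simp [eLpNorm_congr_ae this]

/-- Density of smooth functions is built into `IsTrace`. Hence an inequality continuous in the three
`L²` components need only be proved for smooth functions. -/
theorem exists_tendsto_smoothJet {p : L2Triple Ω} (hp : p ∈ sobolevH1 Ω) :
    ∃ (φ : ℕ → Plane → ℝ) (hφ : ∀ m, ContDiff ℝ ∞ (φ m)),
      Tendsto (fun m => smoothJet h (hφ m)) atTop (𝓝 p) := by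
  obtain ⟨-, φ, hφ, h1, h2, h3⟩ := hp
  have aux : ∀ {E : Type} [NormedAddCommGroup E] {μ : Measure Plane} {f : ℕ → Plane → E}
      (hf : ∀ m, MemLp (f m) 2 μ) (g : Lp E 2 μ),
      Tendsto (fun m => eLpNorm (fun x => f m x - g x) 2 μ) atTop (𝓝 0) →
      Tendsto (fun m => (hf m).toLp (f m)) atTop (𝓝 g) := by
    intro E _ μ f hf g hlim
    rw [Lp.tendsto_Lp_iff_tendsto_eLpNorm']
    refine hlim.congr fun m => eLpNorm_congr_ae ?_
    filter_upwards [(hf m).coeFn_toLp] with x hx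
    simp [hx]
  exact ⟨φ, hφ, (aux _ _ h1).prodMk_nhds ((aux _ _ h2).prodMk_nhds (aux _ _ h3))⟩

end jet

/-! ### From inequalities for smooth functions to minimax eigenvalues -/

/-- Smooth functions `u₁`, `u₂` that behave as the first two Robin eigenfunctions, with eigenvalues
`lam₁`, `lam₂`, as far as the Rayleigh quotients of smooth functions are concerned. -/
structure RobinModes (Ω : Set Plane) (α lam₁ lam₂ A B δ C : ℝ) (u₁ u₂ : Plane → ℝ) : Prop where
  smooth₁ : ContDiff ℝ ∞ u₁
  smooth₂ : ContDiff ℝ ∞ u₂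
  A_pos : 0 < A
  B_pos : 0 < B
  le : lam₁ ≤ lam₂
  first : ∀ φ, ContDiff ℝ ∞ φ → lam₁ * ∫ x in Ω, φ x ^ 2 ≤ smoothEnergy Ω α φ
  second : ∀ φ, ContDiff ℝ ∞ φ →
    lam₂ * (∫ x in Ω, φ x ^ 2) - δ * (∫ x in Ω, φ x * u₁ x) ^ 2 ≤ smoothEnergy Ω α φ
  trace : ∀ φ, ContDiff ℝ ∞ φ →
    ∫ x, φ x ^ 2 ∂(boundaryMeasure Ω) ≤ C * (∫ x in Ω, φ x ^ 2) + ∫ x in Ω, ‖gradient φ x‖ ^ 2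
  energy : ∀ s t, smoothEnergy Ω α (fun x => s * u₁ x + t * u₂ x) =
    s ^ 2 * (lam₁ * A) + t ^ 2 * (lam₂ * B)
  norm : ∀ s t, ∫ x in Ω, (s * u₁ x + t * u₂ x) ^ 2 = s ^ 2 * A + t ^ 2 * B

namespace RobinModes

variable {Ω : Set Plane} {α lam₁ lam₂ A B δ C : ℝ} {u₁ u₂ : Plane → ℝ}

theorem first_sobolev (h : IsTameDomain Ω) (R : RobinModes Ω α lam₁ lam₂ A B δ C u₁ u₂)
    {p : L2Triple Ω} (hp : p ∈ sobolevH1 Ω) : lam₁ * ‖p.1‖ ^ 2 ≤ sobolevEnergy α p := by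
  obtain ⟨φ, hφ, hlim⟩ := exists_tendsto_smoothJet h hp
  have hc : Continuous fun q : L2Triple Ω => sobolevEnergy α q - lam₁ * ‖q.1‖ ^ 2 := by
    unfold sobolevEnergy; fun_prop
  have := ge_of_tendsto' ((hc.tendsto p).comp hlim) (b := 0) fun m => by
    simp only [Function.comp, sobolevEnergy_smoothJet, sq_norm_smoothJet_fst]
    linarith [R.first _ (hφ m)]
  linarith

/-- The penalty `δ ⟨p, u₁⟩²` replaces the constraint `p ⊥ u₁`, which smooth approximants of `p` need
not satisfy. It disappears after the limit, when `p` is orthogonal to `u₁`. -/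
theorem second_sobolev (h : IsTameDomain Ω) (R : RobinModes Ω α lam₁ lam₂ A B δ C u₁ u₂)
    {p : L2Triple Ω} (hp : p ∈ sobolevH1 Ω) :
    lam₂ * ‖p.1‖ ^ 2 - δ * inner ℝ p.1 (smoothJet h R.smooth₁).1 ^ 2 ≤ sobolevEnergy α p := by
  obtain ⟨φ, hφ, hlim⟩ := exists_tendsto_smoothJet h hp
  have hc : Continuous fun q : L2Triple Ω => sobolevEnergy α q -
      (lam₂ * ‖q.1‖ ^ 2 - δ * inner ℝ q.1 (smoothJet h R.smooth₁).1 ^ 2) := by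
    unfold sobolevEnergy; fun_prop
  have := ge_of_tendsto' ((hc.tendsto p).comp hlim) (b := 0) fun m => by
    have e : inner ℝ (smoothJet h (hφ m)).1 (smoothJet h R.smooth₁).1 =
      ∫ x in Ω, φ m x * u₁ x :=
      inner_toLp (h.memLp (hφ m).continuous) (h.memLp R.smooth₁.continuous)
    simp only [Function.comp, sobolevEnergy_smoothJet, sq_norm_smoothJet_fst, e]
    linarith [R.second _ (hφ m)]
  linarith

theorem trace_sobolev (h : IsTameDomain Ω) (R : RobinModes Ω α lam₁ lam₂ A B δ C u₁ u₂)
    {p : L2Triple Ω} (hp : p ∈ sobolevH1 Ω) :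
    ‖p.2.2‖ ^ 2 ≤ C * ‖p.1‖ ^ 2 + ‖p.2.1‖ ^ 2 := by
  obtain ⟨φ, hφ, hlim⟩ := exists_tendsto_smoothJet h hp
  have hc : Continuous fun q : L2Triple Ω => C * ‖q.1‖ ^ 2 + ‖q.2.1‖ ^ 2 - ‖q.2.2‖ ^ 2 := by
    fun_prop
  have := ge_of_tendsto' ((hc.tendsto p).comp hlim) (b := 0) fun m => by
    have := R.trace _ (hφ m)
    simp only [Function.comp, smoothJet, sq_norm_toLp, Real.norm_eq_abs, sq_abs]
    linarith
  linarith

/-- Ensures that Rayleigh quotients have nonzero denominators. If the function component vanishes,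
so does its weak gradient, and then the trace inequality kills the boundary component. -/
theorem fst_ne_zero (h : IsTameDomain Ω) (R : RobinModes Ω α lam₁ lam₂ A B δ C u₁ u₂)
    {p : L2Triple Ω} (hp : p ∈ sobolevH1 Ω) (h0 : p ≠ 0) : p.1 ≠ 0 := by
  intro h1
  have := h.isFiniteMeasure_restrict
  have i : IntegrableOn (p.2.1 : Plane → Plane) Ω := (Lp.memLp p.2.1).integrable (by norm_num)
  have G : ∀ᵐ x, x ∈ Ω → (p.2.1 : Plane → Plane) x = 0 := by
    refine h.isOpen.ae_eq_zero_of_integral_contDiff_smul_eq_zero i.locallyIntegrableOn ?_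
    intro ψ hψ hc hs
    have e := hp.1 ψ hψ hc hs
    have z : ∫ x in Ω, (p.1 : Plane → ℝ) x • gradient ψ x = 0 := by
      rw [h1]
      exact integral_eq_zero_of_ae ((Lp.coeFn_zero ℝ 2 (volume.restrict Ω)).mono fun x hx => by
        change (0 : Lp ℝ 2 (volume.restrict Ω)) x • gradient ψ x = 0
        rw [hx, Pi.zero_apply, zero_smul])
    rw [z, eq_comm, neg_eq_zero] at e
    rw [← e]
    refine (setIntegral_eq_integral_of_forall_compl_eq_zero fun x hx => ?_).symm
    rw [image_eq_zero_of_notMem_tsupport fun h => hx (hs h), zero_smul]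
  have h2 : p.2.1 = 0 := by
    refine Lp.ext ?_
    filter_upwards [(ae_restrict_iff' h.isOpen.measurableSet).2 G,
      Lp.coeFn_zero Plane 2 (volume.restrict Ω)] with x hx hx'
    rw [hx, hx', Pi.zero_apply]
  have h3 := R.trace_sobolev h hp
  rw [h1, h2] at h3
  have h4 : p.2.2 = 0 := by
    have : ‖p.2.2‖ ^ 2 ≤ 0 := by simpa using h3
    exact norm_eq_zero.1 (pow_eq_zero_iff two_ne_zero |>.1 (le_antisymm this (sq_nonneg _)))
  exact h0 (Prod.ext h1 (Prod.ext h2 h4))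

/-- The combinations of the two modes. -/
noncomputable def comb (h : IsTameDomain Ω) (R : RobinModes Ω α lam₁ lam₂ A B δ C u₁ u₂) :
    ℝ × ℝ →ₗ[ℝ] L2Triple Ω :=
  (LinearMap.toSpanSingleton ℝ _ (smoothJet h R.smooth₁)).coprod
    (LinearMap.toSpanSingleton ℝ _ (smoothJet h R.smooth₂))

theorem contDiff_comb (R : RobinModes Ω α lam₁ lam₂ A B δ C u₁ u₂) (s t : ℝ) :
    ContDiff ℝ ∞ fun x => s * u₁ x + t * u₂ x :=
  (contDiff_const.mul R.smooth₁).add (contDiff_const.mul R.smooth₂)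

theorem comb_apply (h : IsTameDomain Ω) (R : RobinModes Ω α lam₁ lam₂ A B δ C u₁ u₂) (s t : ℝ) :
    R.comb h (s, t) = smoothJet h (R.contDiff_comb s t) := by
  rw [← smoothJet_comb h R.smooth₁ R.smooth₂]
  simp [comb]

theorem sq_norm_comb (h : IsTameDomain Ω) (R : RobinModes Ω α lam₁ lam₂ A B δ C u₁ u₂) (s t : ℝ) :
    ‖(R.comb h (s, t)).1‖ ^ 2 = s ^ 2 * A + t ^ 2 * B := by
  rw [comb_apply, sq_norm_smoothJet_fst, R.norm]

theorem robinRayleigh_comb (h : IsTameDomain Ω) (R : RobinModes Ω α lam₁ lam₂ A B δ C u₁ u₂)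
    (s t : ℝ) : robinRayleigh Ω α (R.comb h (s, t)) =
      (s ^ 2 * (lam₁ * A) + t ^ 2 * (lam₂ * B)) / (s ^ 2 * A + t ^ 2 * B) := by
  rw [robinRayleigh_eq, sq_norm_comb, comb_apply, sobolevEnergy_smoothJet, R.energy]

theorem comb_injective (h : IsTameDomain Ω) (R : RobinModes Ω α lam₁ lam₂ A B δ C u₁ u₂) :
    Function.Injective (R.comb h) := by
  refine (injective_iff_map_eq_zero _).2 fun ⟨s, t⟩ hst => ?_
  have := R.sq_norm_comb h s t
  rw [hst] at this
  have hA := R.A_pos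
  have hB := R.B_pos
  have h1 : 0 ≤ s ^ 2 * A := by positivity
  have h2 : 0 ≤ t ^ 2 * B := by positivity
  have h3 : s ^ 2 * A + t ^ 2 * B = 0 := by simpa using this.symm
  have h4 : s ^ 2 * A = 0 := by linarith
  have h5 : t ^ 2 * B = 0 := by linarith
  have h6 : s = 0 := by simpa [hA.ne'] using h4
  have h7 : t = 0 := by simpa [hB.ne'] using h5
  rw [h6, h7]
  rfl

theorem sq_norm_fst_pos (h : IsTameDomain Ω) (R : RobinModes Ω α lam₁ lam₂ A B δ C u₁ u₂)
    {p : L2Triple Ω} (hp : p ∈ sobolevH1 Ω) (h0 : p ≠ 0) : 0 < ‖p.1‖ ^ 2 :=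
  pow_pos (norm_pos_iff.2 (R.fst_ne_zero h hp h0)) 2

theorem robinEigenvalue_one (h : IsTameDomain Ω) (R : RobinModes Ω α lam₁ lam₂ A B δ C u₁ u₂) :
    robinEigenvalue Ω α 1 = lam₁ := by
  have hA := R.A_pos
  refine IsLeast.csInf_eq ⟨?_, ?_⟩
  · have inj : Function.Injective (R.comb h ∘ₗ LinearMap.inl ℝ ℝ ℝ) :=
      (R.comb_injective h).comp LinearMap.inl_injective
    refine ⟨LinearMap.range (R.comb h ∘ₗ LinearMap.inl ℝ ℝ ℝ), ?_, ?_, ?_, ?_⟩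
    · rintro _ ⟨s, rfl⟩
      simp only [LinearMap.comp_apply, LinearMap.inl_apply, comb_apply]
      exact smoothJet_mem_sobolevH1 h _
    · rw [LinearMap.finrank_range_of_inj inj]
      simp
    · refine ⟨_, ⟨1, rfl⟩, (map_ne_zero_iff _ inj).2 one_ne_zero, ?_⟩
      rw [LinearMap.comp_apply, LinearMap.inl_apply, robinRayleigh_comb, eq_div_iff (by simpa using hA.ne')]
      ring
    · rintro _ ⟨_, ⟨s, rfl⟩, h0, rfl⟩
      have hs : s ≠ 0 := fun hs => h0 (by rw [hs, map_zero])
      rw [LinearMap.comp_apply, LinearMap.inl_apply, robinRayleigh_comb]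
      refine le_of_eq ?_
      rw [div_eq_iff (by simpa [hA.ne'] using hs)]
      ring
  · rintro M ⟨U, hU, hk, hM⟩
    have : Nontrivial U := Module.nontrivial_of_finrank_pos (R := ℝ) (by omega)
    obtain ⟨⟨p, hp⟩, h0⟩ := exists_ne (0 : U)
    have h0 : p ≠ 0 := fun h => h0 (Subtype.ext h)
    refine le_trans ?_ (hM.2 ⟨p, hp, h0, rfl⟩)
    rw [robinRayleigh_eq, le_div_iff₀ (R.sq_norm_fst_pos h (hU hp) h0)]
    exact R.first_sobolev h (hU hp)

theorem robinEigenvalue_two (h : IsTameDomain Ω) (R : RobinModes Ω α lam₁ lam₂ A B δ C u₁ u₂) :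
    robinEigenvalue Ω α 2 = lam₂ := by
  have hA := R.A_pos
  have hB := R.B_pos
  refine IsLeast.csInf_eq ⟨?_, ?_⟩
  · refine ⟨LinearMap.range (R.comb h), ?_, ?_, ?_, ?_⟩
    · rintro _ ⟨⟨s, t⟩, rfl⟩
      rw [comb_apply]
      exact smoothJet_mem_sobolevH1 h _
    · rw [LinearMap.finrank_range_of_inj (R.comb_injective h)]
      simp
    · refine ⟨_, ⟨(0, 1), rfl⟩, (map_ne_zero_iff _ (R.comb_injective h)).2 (by simp), ?_⟩
      rw [robinRayleigh_comb]
      field_simp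
      simp
    · rintro _ ⟨_, ⟨⟨s, t⟩, rfl⟩, h0, rfl⟩
      have hs : s ≠ 0 ∨ t ≠ 0 := by
        by_contra! hc
        exact h0 (by rw [hc.1, hc.2]; exact map_zero _)
      have hpos : 0 < s ^ 2 * A + t ^ 2 * B := by rcases hs with hs | hs <;> positivity
      rw [robinRayleigh_comb, div_le_iff₀ hpos]
      have : 0 ≤ s ^ 2 * A := by positivity
      nlinarith [R.le]
  · rintro M ⟨U, hU, hk, hM⟩
    -- A two-dimensional space contains a nonzero vector orthogonal to `u₁`, found in the kernel of
    -- this functional.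
    let T : U →ₗ[ℝ] ℝ :=
      ((innerₛₗ ℝ (smoothJet h R.smooth₁).1).comp (LinearMap.fst ℝ _ _)).comp U.subtype
    have : FiniteDimensional ℝ U := Module.finite_of_finrank_pos (by omega)
    obtain ⟨⟨p, hp⟩, hT, h0⟩ : ∃ x ∈ LinearMap.ker T, x ≠ 0 := by
      refine Submodule.exists_mem_ne_zero_of_ne_bot fun hb => ?_
      have := LinearMap.finrank_le_finrank_of_injective (LinearMap.ker_eq_bot.1 hb)
      rw [hk] at this
      simp at this
    have h0 : p ≠ 0 := fun h => h0 (Subtype.ext h)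
    refine le_trans ?_ (hM.2 ⟨p, hp, h0, rfl⟩)
    rw [robinRayleigh_eq, le_div_iff₀ (R.sq_norm_fst_pos h (hU hp) h0)]
    have hT : inner ℝ (smoothJet h R.smooth₁).1 p.1 = (0 : ℝ) := hT
    have := R.second_sobolev h (hU hp)
    rw [real_inner_comm, hT] at this
    linarith

end RobinModes

/-! ### Invariance under isometries of the plane -/

section isometry

variable (e : Plane ≃ᵢ Plane)

/-- By the Mazur–Ulam theorem an isometry of the plane is affine. -/
theorem IsometryEquiv.eq_linear_add (x : Plane) : e x = e.toRealLinearIsometryEquiv x + e 0 := by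
  simp

theorem IsometryEquiv.contDiff_plane : ContDiff ℝ ∞ e := by
  have : (e : Plane → Plane) = fun x => e.toRealLinearIsometryEquiv x + e 0 :=
    funext e.eq_linear_add
  rw [this]
  exact e.toRealLinearIsometryEquiv.contDiff.add contDiff_const

theorem IsometryEquiv.measurePreserving_plane : MeasurePreserving e := by
  have : (e : Plane → Plane) = (fun x => x + e 0) ∘ e.toRealLinearIsometryEquiv :=
    funext e.eq_linear_add
  rw [this]
  exact (measurePreserving_add_right _ _).comp e.toRealLinearIsometryEquiv.measurePreserving

theorem IsometryEquiv.norm_gradient_comp {φ : Plane → ℝ} (hφ : ContDiff ℝ ∞ φ) (x : Plane) :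
    ‖gradient (φ ∘ e) x‖ = ‖gradient φ (e x)‖ := by
  have hL : HasFDerivAt e (e.toRealLinearIsometryEquiv : Plane →L[ℝ] Plane) x := by
    have : (e : Plane → Plane) = fun x => e.toRealLinearIsometryEquiv x + e 0 :=
      funext e.eq_linear_add
    rw [this]
    exact (e.toRealLinearIsometryEquiv : Plane →L[ℝ] Plane).hasFDerivAt.add_const _
  have := ((hφ.differentiable (by simp) (e x)).hasFDerivAt.comp x hL).fderiv
  simp only [gradient, LinearIsometryEquiv.norm_map]
  rw [this]
  exact ContinuousLinearMap.opNorm_comp_linearIsometryEquiv _ _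

theorem IsometryEquiv.setIntegral_image_plane (Ω : Set Plane) (f : Plane → ℝ) :
    ∫ x in e '' Ω, f x = ∫ x in Ω, f (e x) :=
  e.measurePreserving_plane.setIntegral_image_emb e.toHomeomorph.measurableEmbedding f Ω

theorem IsometryEquiv.boundaryMeasure_image (Ω : Set Plane) :
    MeasurePreserving e (boundaryMeasure Ω) (boundaryMeasure (e '' Ω)) := by
  have := (e.measurePreserving_hausdorffMeasure 1).restrict_image_emb
    e.toHomeomorph.measurableEmbedding (frontier Ω)
  have h : e '' frontier Ω = frontier (e '' Ω) := e.toHomeomorph.image_frontier Ω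
  rwa [h] at this

theorem IsometryEquiv.integral_boundaryMeasure_image (Ω : Set Plane) (f : Plane → ℝ) :
    ∫ x, f x ∂(boundaryMeasure (e '' Ω)) = ∫ x, f (e x) ∂(boundaryMeasure Ω) :=
  ((e.boundaryMeasure_image Ω).integral_comp e.toHomeomorph.measurableEmbedding f).symm

theorem IsometryEquiv.smoothEnergy_image (Ω : Set Plane) (α : ℝ) {φ : Plane → ℝ}
    (hφ : ContDiff ℝ ∞ φ) : smoothEnergy (e '' Ω) α φ = smoothEnergy Ω α (φ ∘ e) := by
  rw [smoothEnergy, smoothEnergy, e.setIntegral_image_plane, e.integral_boundaryMeasure_image]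
  simp_rw [e.norm_gradient_comp hφ]
  rfl

theorem IsTameDomain.image {Ω : Set Plane} (h : IsTameDomain Ω) : IsTameDomain (e '' Ω) where
  isOpen := e.toHomeomorph.isOpenMap _ h.isOpen
  isBounded := e.isometry.lipschitz.isBounded_image h.isBounded
  isFiniteMeasure := by
    have := h.isFiniteMeasure
    rw [← (e.boundaryMeasure_image Ω).map_eq]
    infer_instance

theorem RobinModes.image {Ω : Set Plane} {α lam₁ lam₂ A B δ C : ℝ} {u₁ u₂ : Plane → ℝ}
    (R : RobinModes Ω α lam₁ lam₂ A B δ C u₁ u₂) :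
    RobinModes (e '' Ω) α lam₁ lam₂ A B δ C (u₁ ∘ e.symm) (u₂ ∘ e.symm) where
  smooth₁ := R.smooth₁.comp e.symm.contDiff_plane
  smooth₂ := R.smooth₂.comp e.symm.contDiff_plane
  A_pos := R.A_pos
  B_pos := R.B_pos
  le := R.le
  first φ hφ := by
    rw [e.setIntegral_image_plane, e.smoothEnergy_image _ _ hφ]
    exact R.first _ (hφ.comp e.contDiff_plane)
  second φ hφ := by
    rw [e.setIntegral_image_plane, e.setIntegral_image_plane, e.smoothEnergy_image _ _ hφ]
    simpa using R.second _ (hφ.comp e.contDiff_plane)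
  trace φ hφ := by
    rw [e.setIntegral_image_plane, e.setIntegral_image_plane, e.integral_boundaryMeasure_image]
    simp_rw [← e.norm_gradient_comp hφ]
    exact R.trace _ (hφ.comp e.contDiff_plane)
  energy s t := by
    rw [e.smoothEnergy_image, ← R.energy s t]
    · congr 1
      funext x
      simp
    · exact (contDiff_const.mul (R.smooth₁.comp e.symm.contDiff_plane)).add
        (contDiff_const.mul (R.smooth₂.comp e.symm.contDiff_plane))
  norm s t := by
    rw [e.setIntegral_image_plane, ← R.norm s t]
    simp

end isometry

/-! ### Integration over a rectangle, its boundary and its slices -/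

/-- The rectangle `(-ℓ, ℓ) × (-m, m)`. -/
def centeredRectangle (ℓ m : ℝ) : Set Plane :=
  {x | x 0 ∈ Ioo (-ℓ) ℓ ∧ x 1 ∈ Ioo (-m) m}

/-- The coordinates of the plane. -/
noncomputable def planeHomeomorph : Plane ≃ₜ ℝ × ℝ :=
  (PiLp.homeomorph 2 _).trans Homeomorph.finTwoArrow

theorem planeHomeomorph_apply (x : Plane) : planeHomeomorph x = (x 0, x 1) := rfl

theorem planeHomeomorph_symm_apply (x y : ℝ) : planeHomeomorph.symm (x, y) = !₂[x, y] := by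
  rw [Homeomorph.symm_apply_eq, planeHomeomorph_apply]
  simp

theorem continuous_planePoint : Continuous fun z : ℝ × ℝ => (!₂[z.1, z.2] : Plane) := by
  simp_rw [← planeHomeomorph_symm_apply]
  exact planeHomeomorph.symm.continuous

theorem centeredRectangle_eq_preimage (ℓ m : ℝ) :
    centeredRectangle ℓ m = planeHomeomorph ⁻¹' (Ioo (-ℓ) ℓ ×ˢ Ioo (-m) m) := rfl

theorem measurePreserving_planeHomeomorph : MeasurePreserving planeHomeomorph :=
  (volume_preserving_finTwoArrow ℝ).comp (PiLp.volume_preserving_ofLp (Fin 2))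

theorem Continuous.integrableOn_uncurry {F : ℝ → ℝ → ℝ} (hF : Continuous F.uncurry)
    (a b c d : ℝ) : IntegrableOn F.uncurry (uIoc a b ×ˢ uIoc c d) :=
  (hF.continuousOn.integrableOn_compact (isCompact_uIcc.prod isCompact_uIcc)).mono_set
    (Set.prod_mono uIoc_subset_uIcc uIoc_subset_uIcc)

theorem integral_swap_of_continuous {F : ℝ → ℝ → ℝ} (hF : Continuous F.uncurry) (a b c d : ℝ) :
    ∫ x in a..b, ∫ y in c..d, F x y = ∫ y in c..d, ∫ x in a..b, F x y :=
  intervalIntegral_intervalIntegral_swap (hF.integrableOn_uncurry a b c d)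

theorem setIntegral_centeredRectangle {ℓ m : ℝ} (hℓ : 0 < ℓ) (hm : 0 < m) {f : Plane → ℝ}
    (hf : Continuous f) :
    ∫ p in centeredRectangle ℓ m, f p = ∫ x in (-ℓ)..ℓ, ∫ y in (-m)..m, f !₂[x, y] := by
  have h := measurePreserving_planeHomeomorph.setIntegral_preimage_emb
    planeHomeomorph.measurableEmbedding (f ∘ planeHomeomorph.symm) (Ioo (-ℓ) ℓ ×ˢ Ioo (-m) m)
  simp only [Function.comp_apply, Homeomorph.symm_apply_apply] at h
  rw [centeredRectangle_eq_preimage, h, Measure.volume_eq_prod, setIntegral_prod]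
  · rw [intervalIntegral.integral_of_le (by linarith), integral_Ioc_eq_integral_Ioo]
    simp_rw [intervalIntegral.integral_of_le (show -m ≤ m by linarith),
      integral_Ioc_eq_integral_Ioo, planeHomeomorph_symm_apply]
  · exact ((hf.comp planeHomeomorph.symm.continuous).continuousOn.integrableOn_compact
      (isCompact_Icc.prod isCompact_Icc)).mono_set (Set.prod_mono Ioo_subset_Icc_self Ioo_subset_Icc_self)

theorem isometry_horizontal (c : ℝ) : Isometry fun t : ℝ => (!₂[t, c] : Plane) :=
  Isometry.of_dist_eq fun s t => by simp [EuclideanSpace.dist_eq, Real.sqrt_sq]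

theorem isometry_vertical (c : ℝ) : Isometry fun t : ℝ => (!₂[c, t] : Plane) :=
  Isometry.of_dist_eq fun s t => by simp [EuclideanSpace.dist_eq, Real.sqrt_sq]

theorem setIntegral_isometry_image {γ : ℝ → Plane} (hγ : Isometry γ) (s : Set ℝ) (f : Plane → ℝ) :
    ∫ p in γ '' s, f p ∂(Measure.hausdorffMeasure 1) = ∫ t in s, f (γ t) := by
  have hp : MeasurePreserving γ (Measure.hausdorffMeasure 1)
      ((Measure.hausdorffMeasure 1).restrict (range γ)) :=
    ⟨hγ.continuous.measurable, hγ.map_hausdorffMeasure (Or.inl zero_le_one)⟩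
  have := hp.setIntegral_image_emb hγ.isClosedEmbedding.measurableEmbedding f s
  rwa [Measure.restrict_restrict_of_subset (image_subset_range _ _), hausdorffMeasure_real] at this

theorem frontier_centeredRectangle {ℓ m : ℝ} (hℓ : 0 < ℓ) (hm : 0 < m) :
    frontier (centeredRectangle ℓ m) =
      (((fun t => !₂[t, m]) '' Icc (-ℓ) ℓ) ∪ ((fun t => !₂[t, -m]) '' Icc (-ℓ) ℓ)) ∪
      (((fun t => !₂[ℓ, t]) '' Icc (-m) m) ∪ ((fun t => !₂[-ℓ, t]) '' Icc (-m) m)) := by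
  have hH : ∀ c : ℝ, (fun t : ℝ => (!₂[t, c] : Plane)) '' Icc (-ℓ) ℓ =
      planeHomeomorph ⁻¹' (Icc (-ℓ) ℓ ×ˢ {c}) := fun c => by
    rw [← Homeomorph.image_symm, prod_singleton, image_image]
    simp_rw [planeHomeomorph_symm_apply]
  have hV : ∀ c : ℝ, (fun t : ℝ => (!₂[c, t] : Plane)) '' Icc (-m) m =
      planeHomeomorph ⁻¹' ({c} ×ˢ Icc (-m) m) := fun c => by
    rw [← Homeomorph.image_symm, singleton_prod, image_image]
    simp_rw [planeHomeomorph_symm_apply]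
  rw [hH, hH, hV, hV, centeredRectangle_eq_preimage, ← Homeomorph.preimage_frontier,
    frontier_prod_eq, frontier_Ioo (by linarith), frontier_Ioo (by linarith),
    closure_Ioo (by linarith), closure_Ioo (by linarith), ← preimage_union, ← preimage_union,
    ← preimage_union, ← prod_union, ← union_prod, singleton_union, singleton_union, pair_comm m,
    pair_comm ℓ]

theorem isTameDomain_centeredRectangle {ℓ m : ℝ} (hℓ : 0 < ℓ) (hm : 0 < m) :
    IsTameDomain (centeredRectangle ℓ m) where
  isOpen := (isOpen_Ioo.prod isOpen_Ioo).preimage planeHomeomorph.continuous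
  isBounded := by
    have : IsCompact (planeHomeomorph ⁻¹' (Icc (-ℓ) ℓ ×ˢ Icc (-m) m)) :=
      planeHomeomorph.isCompact_preimage.2 (isCompact_Icc.prod isCompact_Icc)
    rw [centeredRectangle_eq_preimage]
    exact this.isBounded.subset
      (preimage_mono (Set.prod_mono Ioo_subset_Icc_self Ioo_subset_Icc_self))
  isFiniteMeasure := by
    refine ⟨?_⟩
    rw [boundaryMeasure, Measure.restrict_apply_univ, frontier_centeredRectangle hℓ hm]
    have : ∀ {γ : ℝ → Plane} {a b : ℝ}, Isometry γ →
        Measure.hausdorffMeasure 1 (γ '' Icc a b) < ⊤ := fun hγ => by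
      rw [hγ.hausdorffMeasure_image (Or.inl zero_le_one), hausdorffMeasure_real]
      exact measure_Icc_lt_top
    exact measure_union_lt_top
      (measure_union_lt_top (this (isometry_horizontal _)) (this (isometry_horizontal _)))
      (measure_union_lt_top (this (isometry_vertical _)) (this (isometry_vertical _)))

theorem integral_boundaryMeasure_centeredRectangle {ℓ m : ℝ} (hℓ : 0 < ℓ) (hm : 0 < m)
    {f : Plane → ℝ} (hf : Continuous f) :
    ∫ p, f p ∂(boundaryMeasure (centeredRectangle ℓ m)) =
      ((∫ x in (-ℓ)..ℓ, f !₂[x, m]) + ∫ x in (-ℓ)..ℓ, f !₂[x, -m]) +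
      ((∫ y in (-m)..m, f !₂[ℓ, y]) + ∫ y in (-m)..m, f !₂[-ℓ, y]) := by
  have hint : ∀ {γ : ℝ → Plane} {a b : ℝ}, Isometry γ →
      IntegrableOn f (γ '' Icc a b) (Measure.hausdorffMeasure 1) := fun {γ a b} hγ => by
    have hfin : Measure.hausdorffMeasure 1 (γ '' Icc a b) < ⊤ := by
      rw [hγ.hausdorffMeasure_image (Or.inl zero_le_one), hausdorffMeasure_real]
      exact measure_Icc_lt_top
    have hc : IsCompact (γ '' Icc a b) := isCompact_Icc.image hγ.continuous
    obtain ⟨C, hC⟩ := hc.exists_bound_of_continuousOn hf.continuousOn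
    exact IntegrableOn.of_bound hfin hf.aestronglyMeasurable C
      ((ae_restrict_mem hc.measurableSet).mono fun x hx => hC x hx)
  have hms : ∀ {γ : ℝ → Plane} {a b : ℝ}, Isometry γ → MeasurableSet (γ '' Icc a b) := fun hγ =>
    (isCompact_Icc.image hγ.continuous).measurableSet
  have hI : ∀ {γ : ℝ → Plane} {a : ℝ}, Isometry γ → 0 < a →
      ∫ p in γ '' Icc (-a) a, f p ∂(Measure.hausdorffMeasure 1) = ∫ t in (-a)..a, f (γ t) :=
    fun hγ ha => by
      rw [setIntegral_isometry_image hγ, integral_Icc_eq_integral_Ioc,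
        intervalIntegral.integral_of_le (by linarith)]
  have na : NullSingletonClass (Measure.hausdorffMeasure 1 : Measure Plane) :=
    Measure.nullSingletonClass_hausdorff Plane one_pos
  have c1 := isometry_horizontal m
  have c2 := isometry_horizontal (-m)
  have c3 := isometry_vertical ℓ
  have c4 := isometry_vertical (-ℓ)
  rw [boundaryMeasure, frontier_centeredRectangle hℓ hm, setIntegral_union₀ _
      ((hms c3).union (hms c4)).nullMeasurableSet ((hint c1).union (hint c2))
      ((hint c3).union (hint c4)),
    setIntegral_union _ (hms c2) (hint c1) (hint c2),
    setIntegral_union _ (hms c4) (hint c3) (hint c4), hI c1 hℓ, hI c2 hℓ, hI c3 hm, hI c4 hm]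
  · rw [disjoint_left]
    rintro _ ⟨s, -, rfl⟩ ⟨t, -, h⟩
    have := congrFun (congrArg WithLp.ofLp h) 0
    simp at this
    linarith
  · rw [disjoint_left]
    rintro _ ⟨s, -, rfl⟩ ⟨t, -, h⟩
    have := congrFun (congrArg WithLp.ofLp h) 1
    simp at this
    linarith
  -- Horizontal and vertical sides meet only in the four corners, which are null for one-dimensional
  -- Hausdorff measure.
  · refine measure_mono_null (t := {!₂[ℓ, m], !₂[ℓ, -m], !₂[-ℓ, m], !₂[-ℓ, -m]}) ?_
      (Set.Finite.measure_zero (by simp) _)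
    rintro _ ⟨⟨s, -, rfl⟩ | ⟨s, -, rfl⟩, ⟨t, -, h⟩ | ⟨t, -, h⟩⟩
    all_goals
      have e0 := congrFun (congrArg WithLp.ofLp h) 0
      have e1 := congrFun (congrArg WithLp.ofLp h) 1
      simp at e0 e1
      subst e0 e1
      simp

theorem planePoint_eq (x y : ℝ) : (!₂[x, y] : Plane) =
    x • EuclideanSpace.single 0 1 + y • EuclideanSpace.single 1 1 := by
  ext i
  fin_cases i <;> simp

theorem hasDerivAt_planePoint_fst (x y : ℝ) :
    HasDerivAt (fun x => (!₂[x, y] : Plane)) (EuclideanSpace.single 0 1) x := by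
  simp_rw [planePoint_eq]
  simpa using ((hasDerivAt_id x).smul_const (EuclideanSpace.single 0 1 : Plane)).add_const
    (y • (EuclideanSpace.single 1 1 : Plane))

theorem hasDerivAt_planePoint_snd (x y : ℝ) :
    HasDerivAt (fun y => (!₂[x, y] : Plane)) (EuclideanSpace.single 1 1) y := by
  simp_rw [planePoint_eq]
  simpa using ((hasDerivAt_id y).smul_const (EuclideanSpace.single 1 1 : Plane)).const_add
    (x • (EuclideanSpace.single 0 1 : Plane))

section slices

variable {φ : Plane → ℝ}

theorem hasDerivAt_slice_fst (hφ : ContDiff ℝ ∞ φ) (x y : ℝ) : HasDerivAt (fun x => φ !₂[x, y])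
    (fderiv ℝ φ !₂[x, y] (EuclideanSpace.single 0 1)) x :=
  (hφ.differentiable (by simp) _).hasFDerivAt.comp_hasDerivAt x (hasDerivAt_planePoint_fst x y)

theorem hasDerivAt_slice_snd (hφ : ContDiff ℝ ∞ φ) (x y : ℝ) : HasDerivAt (fun y => φ !₂[x, y])
    (fderiv ℝ φ !₂[x, y] (EuclideanSpace.single 1 1)) y :=
  (hφ.differentiable (by simp) _).hasFDerivAt.comp_hasDerivAt y (hasDerivAt_planePoint_snd x y)

theorem continuous_fderiv_planePoint (hφ : ContDiff ℝ ∞ φ) (v : Plane) :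
    Continuous fun z : ℝ × ℝ => fderiv ℝ φ !₂[z.1, z.2] v :=
  ((hφ.continuous_fderiv (by simp)).comp continuous_planePoint).clm_apply continuous_const

theorem sq_norm_gradient_eq (p : Plane) : ‖gradient φ p‖ ^ 2 =
    fderiv ℝ φ p (EuclideanSpace.single 0 1) ^ 2 +
    fderiv ℝ φ p (EuclideanSpace.single 1 1) ^ 2 := by
  have : ∀ i, gradient φ p i = fderiv ℝ φ p (EuclideanSpace.single i 1) := fun i => by
    rw [← inner_gradient_left, EuclideanSpace.inner_single_right]
    simp
  rw [EuclideanSpace.real_norm_sq_eq, Fin.sum_univ_two, this, this]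

end slices

/-- The Robin energy of a smooth function on a rectangle is the sum of the energies of its
slices. -/
theorem smoothEnergy_centeredRectangle {ℓ m α : ℝ} (hℓ : 0 < ℓ) (hm : 0 < m) {φ : Plane → ℝ}
    (hφ : ContDiff ℝ ∞ φ) {Fx Fy : ℝ → ℝ → ℝ}
    (hx : ∀ x y, HasDerivAt (fun x => φ !₂[x, y]) (Fx x y) x)
    (hy : ∀ x y, HasDerivAt (fun y => φ !₂[x, y]) (Fy x y) y) :
    smoothEnergy (centeredRectangle ℓ m) α φ =
      (∫ y in (-m)..m, robinForm α ℓ (fun x => φ !₂[x, y]) (fun x => Fx x y)) +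
      ∫ x in (-ℓ)..ℓ, robinForm α m (fun y => φ !₂[x, y]) (fun y => Fy x y) := by
  -- Partial derivatives are unique. Leaving `Fx` and `Fy` free in the statement lets products of
  -- modes use their explicit derivatives.
  obtain rfl : Fx = fun x y => fderiv ℝ φ !₂[x, y] (EuclideanSpace.single 0 1) := by
    ext x y
    exact (hx x y).unique (hasDerivAt_slice_fst hφ x y)
  obtain rfl : Fy = fun x y => fderiv ℝ φ !₂[x, y] (EuclideanSpace.single 1 1) := by
    ext x y
    exact (hy x y).unique (hasDerivAt_slice_snd hφ x y)
  have c1 := continuous_fderiv_planePoint hφ (EuclideanSpace.single 0 1)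
  have c2 := continuous_fderiv_planePoint hφ (EuclideanSpace.single 1 1)
  have cφ := hφ.continuous
  have cφ1 : ∀ c, Continuous fun t : ℝ => φ !₂[t, c] := fun c =>
    cφ.comp (isometry_horizontal c).continuous
  have cφ2 : ∀ c, Continuous fun t : ℝ => φ !₂[c, t] := fun c =>
    cφ.comp (isometry_vertical c).continuous
  have c1' : Continuous (Function.uncurry fun x y : ℝ =>
      fderiv ℝ φ !₂[x, y] (EuclideanSpace.single 0 1) ^ 2) := c1.pow 2
  have c2' : Continuous (Function.uncurry fun x y : ℝ =>
      fderiv ℝ φ !₂[x, y] (EuclideanSpace.single 1 1) ^ 2) := c2.pow 2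
  have i1 : Continuous fun x : ℝ => ∫ y in (-m)..m,
      fderiv ℝ φ !₂[x, y] (EuclideanSpace.single 0 1) ^ 2 :=
    intervalIntegral.continuous_parametric_intervalIntegral_of_continuous' c1' _ _
  have i2 : Continuous fun x : ℝ => ∫ y in (-m)..m,
      fderiv ℝ φ !₂[x, y] (EuclideanSpace.single 1 1) ^ 2 :=
    intervalIntegral.continuous_parametric_intervalIntegral_of_continuous' c2' _ _
  have i1' : Continuous fun y : ℝ => ∫ x in (-ℓ)..ℓ,
      fderiv ℝ φ !₂[x, y] (EuclideanSpace.single 0 1) ^ 2 :=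
    intervalIntegral.continuous_parametric_intervalIntegral_of_continuous'
      (f := fun y x => fderiv ℝ φ !₂[x, y] (EuclideanSpace.single 0 1) ^ 2)
      (c1'.comp continuous_swap) _ _
  have G : ∫ p in centeredRectangle ℓ m, ‖gradient φ p‖ ^ 2 =
      (∫ y in (-m)..m, ∫ x in (-ℓ)..ℓ, fderiv ℝ φ !₂[x, y] (EuclideanSpace.single 0 1) ^ 2) +
      ∫ x in (-ℓ)..ℓ, ∫ y in (-m)..m, fderiv ℝ φ !₂[x, y] (EuclideanSpace.single 1 1) ^ 2 := by
    rw [setIntegral_centeredRectangle (f := fun p => ‖gradient φ p‖ ^ 2) hℓ hm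
        (hφ.continuous_gradient.norm.pow 2),
      ← integral_swap_of_continuous c1', ← intervalIntegral.integral_add
        (i1.intervalIntegrable _ _) (i2.intervalIntegrable _ _)]
    refine intervalIntegral.integral_congr fun x _ => ?_
    simp only [sq_norm_gradient_eq]
    exact intervalIntegral.integral_add
      ((c1'.comp (Continuous.prodMk_right x)).intervalIntegrable _ _)
      ((c2'.comp (Continuous.prodMk_right x)).intervalIntegrable _ _)
  rw [smoothEnergy, G, integral_boundaryMeasure_centeredRectangle (f := fun p => φ p ^ 2) hℓ hm
    (cφ.pow 2)]
  simp only [robinForm]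
  rw [intervalIntegral.integral_add (i1'.intervalIntegrable _ _),
    intervalIntegral.integral_add (i2.intervalIntegrable _ _),
    intervalIntegral.integral_const_mul, intervalIntegral.integral_const_mul,
    intervalIntegral.integral_add, intervalIntegral.integral_add]
  · ring
  all_goals
    apply Continuous.intervalIntegrable
    first
      | exact (cφ1 _).pow 2
      | exact (cφ2 _).pow 2
      | exact continuous_const.mul (((cφ1 _).pow 2).add ((cφ1 _).pow 2))
      | exact continuous_const.mul (((cφ2 _).pow 2).add ((cφ2 _).pow 2))

/-! ### Robin inequalities integrated over slices -/

theorem contDiff_of_ode {μ : ℝ} {v v' : ℝ → ℝ} (hv : ∀ x, HasDerivAt v (v' x) x)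
    (hv' : ∀ x, HasDerivAt v' (-μ * v x) x) : ContDiff ℝ ∞ v := by
  have e : deriv v = v' := funext fun x => (hv x).deriv
  have e' : deriv v' = fun x => -μ * v x := funext fun x => (hv' x).deriv
  have d : Differentiable ℝ v := fun x => (hv x).differentiableAt
  have d' : Differentiable ℝ v' := fun x => (hv' x).differentiableAt
  have key : ∀ n : ℕ, ContDiff ℝ n v ∧ ContDiff ℝ n v' := by
    intro n
    induction n with
    | zero => exact ⟨contDiff_zero.2 d.continuous, contDiff_zero.2 d'.continuous⟩
    | succ n ih =>
      push_cast
      refine ⟨contDiff_succ_iff_deriv.2 ⟨d, by simp, e ▸ ih.2⟩,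
        contDiff_succ_iff_deriv.2 ⟨d', by simp, ?_⟩⟩
      rw [e']
      exact contDiff_const.mul ih.1
  exact contDiff_infty.2 fun n => (key n).1

theorem Continuous.uncurry_sq {F : ℝ → ℝ → ℝ} (hF : Continuous F.uncurry) :
    Continuous (Function.uncurry fun x y => F x y ^ 2) :=
  hF.pow 2

theorem continuous_slice_integral {F : ℝ → ℝ → ℝ} (hF : Continuous F.uncurry) (a b : ℝ) :
    Continuous fun y => ∫ x in a..b, F x y :=
  intervalIntegral.continuous_parametric_intervalIntegral_of_continuous'
    (f := fun y x => F x y) (hF.comp continuous_swap) _ _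

/-- Fubini turns the function into a primitive of the integral of `Fy`, so the fundamental theorem
of calculus replaces a domination argument. -/
theorem hasDerivAt_slice_integral {F Fy : ℝ → ℝ → ℝ} (hF : Continuous F.uncurry)
    (hFy : Continuous Fy.uncurry) (hy : ∀ x y, HasDerivAt (F x) (Fy x y) y) (a b y : ℝ) :
    HasDerivAt (fun y => ∫ x in a..b, F x y) (∫ x in a..b, Fy x y) y := by
  have hF0 : ∀ y, Continuous fun x => F x y := fun y => hF.comp (Continuous.prodMk_left y)
  have hI : Continuous fun x => ∫ t in 0..y, Fy x t :=
    intervalIntegral.continuous_parametric_intervalIntegral_of_continuous' hFy _ _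
  have e : (fun y => ∫ x in a..b, F x y) =
      fun y => (∫ t in 0..y, ∫ x in a..b, Fy x t) + ∫ x in a..b, F x 0 := by
    funext y
    rw [← integral_swap_of_continuous hFy, ← intervalIntegral.integral_add
      (Continuous.intervalIntegrable
        (intervalIntegral.continuous_parametric_intervalIntegral_of_continuous' hFy _ _) _ _)
      ((hF0 0).intervalIntegrable _ _)]
    refine intervalIntegral.integral_congr fun x _ => ?_
    rw [intervalIntegral.integral_eq_sub_of_hasDerivAt (fun t _ => hy x t)
      ((hFy.comp (Continuous.prodMk_right x)).intervalIntegrable _ _)]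
    ring
  rw [e]
  exact ((continuous_slice_integral hFy a b).integral_hasStrictDerivAt 0 y).hasDerivAt.add_const _

section twoDim

variable {α ℓ m μ ν μ' ν' : ℝ} {v v' w w' V V' W W' : ℝ → ℝ} {F Fx Fy : ℝ → ℝ → ℝ}

theorem continuous_robinForm_slice (hF : Continuous F.uncurry) (hFx : Continuous Fx.uncurry) :
    Continuous fun y => robinForm α ℓ (fun x => F x y) (fun x => Fx x y) := by
  have h : ∀ c, Continuous fun y => F c y := fun c => hF.comp (Continuous.prodMk_right c)
  exact (continuous_slice_integral (F := fun x y => Fx x y ^ 2) hFx.uncurry_sq _ _).add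
    (continuous_const.mul (((h ℓ).pow 2).add ((h (-ℓ)).pow 2)))

/-- The first Robin inequality for slices, integrated. -/
theorem EvenGround.le_integral_robinForm (hℓ : 0 < ℓ) (hm : 0 < m)
    (h : EvenGround α ℓ μ v v') (hF : Continuous F.uncurry) (hFx : Continuous Fx.uncurry)
    (hx : ∀ x y, HasDerivAt (fun x => F x y) (Fx x y) x) :
    μ * ∫ y in (-m)..m, ∫ x in (-ℓ)..ℓ, F x y ^ 2 ≤
      ∫ y in (-m)..m, robinForm α ℓ (fun x => F x y) (fun x => Fx x y) := by
  rw [← intervalIntegral.integral_const_mul]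
  refine intervalIntegral.integral_mono_on (by linarith) ?_ ?_ fun y _ => ?_
  · exact (continuous_const.mul (continuous_slice_integral (F := fun x y => F x y ^ 2)
      hF.uncurry_sq _ _)).intervalIntegrable _ _
  · exact (continuous_robinForm_slice hF hFx).intervalIntegrable _ _
  · exact h.le_robinForm hℓ (fun x => hx x y) (hFx.comp (Continuous.prodMk_left y))

/-- The gap inequality for slices, integrated. -/
theorem EvenGround.gap_integral_robinForm (hℓ : 0 < ℓ) (hm : 0 < m)
    (h : EvenGround α ℓ μ v v') (k : OddGround α ℓ ν V V') (hF : Continuous F.uncurry)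
    (hFx : Continuous Fx.uncurry) (hx : ∀ x y, HasDerivAt (fun x => F x y) (Fx x y) x) :
    ν * (∫ y in (-m)..m, ∫ x in (-ℓ)..ℓ, F x y ^ 2) -
      (ν - μ) / (∫ x in (-ℓ)..ℓ, v x ^ 2) * (∫ y in (-m)..m, (∫ x in (-ℓ)..ℓ, F x y * v x) ^ 2) ≤
      ∫ y in (-m)..m, robinForm α ℓ (fun x => F x y) (fun x => Fx x y) := by
  have cv := continuous_of_hasDerivAt h.hasDeriv
  have c1 : Continuous fun y => ∫ x in (-ℓ)..ℓ, F x y ^ 2 :=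
    continuous_slice_integral (F := fun x y => F x y ^ 2) hF.uncurry_sq _ _
  have c2 : Continuous fun y => (∫ x in (-ℓ)..ℓ, F x y * v x) ^ 2 :=
    (continuous_slice_integral (F := fun x y => F x y * v x)
      (hF.mul (cv.comp continuous_fst)) _ _).pow 2
  rw [← intervalIntegral.integral_const_mul, ← intervalIntegral.integral_const_mul,
    ← intervalIntegral.integral_sub
      (Continuous.intervalIntegrable (by fun_prop) _ _)
      (Continuous.intervalIntegrable (by fun_prop) _ _)]
  refine intervalIntegral.integral_mono_on (by linarith) ?_ ?_ fun y _ => ?_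
  · exact ((continuous_const.mul c1).sub (continuous_const.mul c2)).intervalIntegrable _ _
  · exact (continuous_robinForm_slice hF hFx).intervalIntegrable _ _
  · have cFx : Continuous fun x => Fx x y := hFx.comp (Continuous.prodMk_left y)
    rw [h.robinForm_eq hℓ (fun x => hx x y) cFx]
    have := h.gap_inequality hℓ k (fun x => hx x y) cFx
    have e : (ν - μ) / (∫ x in (-ℓ)..ℓ, v x ^ 2) * (∫ x in (-ℓ)..ℓ, F x y * v x) ^ 2 =
      (ν - μ) * ((∫ x in (-ℓ)..ℓ, F x y * v x) ^ 2 / ∫ x in (-ℓ)..ℓ, v x ^ 2) := by ring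
    rw [e]
    linarith

/-- Bessel's inequality: the energy excess of all slices in one direction controls that of their
mean against a function of the other variable. -/
theorem EvenGround.mean_integral_robinForm (hℓ : 0 < ℓ) (hm : 0 < m)
    (hw : EvenGround α m μ w w') (kw : OddGround α m ν W W') (cv : Continuous v)
    (hpos : 0 < ∫ x in (-ℓ)..ℓ, v x ^ 2) (hF : Continuous F.uncurry)
    (hFy : Continuous Fy.uncurry) (hy : ∀ x y, HasDerivAt (F x) (Fy x y) y) :
    μ * (∫ x in (-ℓ)..ℓ, ∫ y in (-m)..m, F x y ^ 2) + (ν - μ) / (∫ x in (-ℓ)..ℓ, v x ^ 2) *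
      ((∫ y in (-m)..m, (∫ x in (-ℓ)..ℓ, F x y * v x) ^ 2) -
        (∫ y in (-m)..m, (∫ x in (-ℓ)..ℓ, F x y * v x) * w y) ^ 2 / ∫ y in (-m)..m, w y ^ 2) ≤
      ∫ x in (-ℓ)..ℓ, robinForm α m (F x) (Fy x) := by
  have cw := continuous_of_hasDerivAt hw.hasDeriv
  have cw' := continuous_of_hasDerivAt hw.hasDeriv'
  have hmm : -m ≤ m := by linarith
  -- a continuous extension of the logarithmic derivative of `w`
  obtain ⟨r, cr, hr⟩ : ∃ r : ℝ → ℝ, Continuous r ∧ ∀ y ∈ Icc (-m) m, r y = w' y / w y := by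
    have hc : ContinuousOn (fun y => w' y / w y) (Icc (-m) m) :=
      cw'.continuousOn.div cw.continuousOn fun y hy => (hw.pos y hy).ne'
    exact ⟨IccExtend hmm ((Icc (-m) m).domRestrict fun y => w' y / w y),
      (continuousOn_iff_continuous_domRestrict.1 hc).Icc_extend',
      fun y hy => by simp [IccExtend_of_mem hmm _ hy, Set.domRestrict]⟩
  have hD : Continuous (Function.uncurry fun x y => (Fy x y - r y * F x y) ^ 2) :=
    (hFy.sub ((cr.comp continuous_snd).mul hF)).pow 2
  have hDv : Continuous (Function.uncurry fun x y => (Fy x y - r y * F x y) * v x) :=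
    (hFy.sub ((cr.comp continuous_snd).mul hF)).mul (cv.comp continuous_fst)
  have hFv : Continuous (Function.uncurry fun x y => F x y * v x) :=
    hF.mul (cv.comp continuous_fst)
  have hFyv : Continuous (Function.uncurry fun x y => Fy x y * v x) :=
    hFy.mul (cv.comp continuous_fst)
  have e1 : ∫ x in (-ℓ)..ℓ, robinForm α m (F x) (Fy x) =
      (∫ y in (-m)..m, ∫ x in (-ℓ)..ℓ, (Fy x y - r y * F x y) ^ 2) +
      μ * ∫ x in (-ℓ)..ℓ, ∫ y in (-m)..m, F x y ^ 2 := by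
    rw [← integral_swap_of_continuous hD, ← intervalIntegral.integral_const_mul,
      ← intervalIntegral.integral_add]
    · refine intervalIntegral.integral_congr fun x _ => ?_
      rw [hw.robinForm_eq hm (hy x) (hFy.comp (Continuous.prodMk_right x))]
      congr 1
      refine intervalIntegral.integral_congr fun y hy => ?_
      rw [uIcc_of_le hmm] at hy
      simp only [hr y hy]
    · exact (intervalIntegral.continuous_parametric_intervalIntegral_of_continuous' hD
        _ _).intervalIntegrable _ _
    · exact (continuous_const.mul
        (intervalIntegral.continuous_parametric_intervalIntegral_of_continuous'
          (f := fun x y => F x y ^ 2) hF.uncurry_sq _ _)).intervalIntegrable _ _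
  -- Up to normalization, `c y` is the coefficient of the slice `F · y` along `v`.
  set c := fun y => ∫ x in (-ℓ)..ℓ, F x y * v x with hc
  set c' := fun y => ∫ x in (-ℓ)..ℓ, Fy x y * v x with hc'
  have dc : ∀ y, HasDerivAt c (c' y) y := fun y =>
    hasDerivAt_slice_integral hFv hFyv (fun x y => (hy x y).mul_const (v x)) _ _ y
  have cc' : Continuous c' := continuous_slice_integral hFyv _ _
  have cc := continuous_of_hasDerivAt dc
  have e2 : ∀ y, ∫ x in (-ℓ)..ℓ, (Fy x y - r y * F x y) * v x = c' y - r y * c y := fun y => by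
    have e : ∀ x, (Fy x y - r y * F x y) * v x = Fy x y * v x - r y * (F x y * v x) := fun x => by
      ring
    simp_rw [e]
    rw [intervalIntegral.integral_sub, intervalIntegral.integral_const_mul]
    · exact (hFyv.comp (Continuous.prodMk_left y)).intervalIntegrable _ _
    · exact (continuous_const.mul (hFv.comp (Continuous.prodMk_left y))).intervalIntegrable _ _
  -- Cauchy–Schwarz in `x`, for each `y`: the square for `c` is controlled by the squares for the
  -- slices. The gap inequality in `y` is then applied to `c` itself.
  have B : (∫ y in (-m)..m, (c' y - w' y / w y * c y) ^ 2) / (∫ x in (-ℓ)..ℓ, v x ^ 2) ≤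
      ∫ y in (-m)..m, ∫ x in (-ℓ)..ℓ, (Fy x y - r y * F x y) ^ 2 := by
    have e3 : ∫ y in (-m)..m, (c' y - w' y / w y * c y) ^ 2 =
        ∫ y in (-m)..m, (c' y - r y * c y) ^ 2 := by
      refine intervalIntegral.integral_congr fun y hy => ?_
      rw [uIcc_of_le hmm] at hy
      simp only [hr y hy]
    rw [e3, ← intervalIntegral.integral_div]
    refine intervalIntegral.integral_mono_on hmm ?_ ?_ fun y _ => ?_
    · exact Continuous.intervalIntegrable (by fun_prop) _ _
    · exact (continuous_slice_integral hD _ _).intervalIntegrable _ _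
    · rw [← e2 y]
      exact integral_mul_sq_div_le (by linarith)
        ((hFy.sub ((cr.comp continuous_snd).mul hF)).comp
          (Continuous.prodMk_left y)).continuousOn cv hpos
  have G := div_le_div_of_nonneg_right (hw.gap_inequality hm kw dc cc') hpos.le
  rw [e1]
  have e4 : (ν - μ) / (∫ x in (-ℓ)..ℓ, v x ^ 2) * ((∫ y in (-m)..m, c y ^ 2) -
      (∫ y in (-m)..m, c y * w y) ^ 2 / ∫ y in (-m)..m, w y ^ 2) =
      (ν - μ) * ((∫ y in (-m)..m, c y ^ 2) -
      (∫ y in (-m)..m, c y * w y) ^ 2 / ∫ y in (-m)..m, w y ^ 2) / (∫ x in (-ℓ)..ℓ, v x ^ 2) := by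
    ring
  rw [e4]
  linarith

/-- The second Robin inequality on a rectangle, if the gap in the first direction is at most the
gap in the second one. -/
theorem second_robin_inequality (hℓ : 0 < ℓ) (hm : 0 < m)
    (h : EvenGround α ℓ μ v v') (k : OddGround α ℓ ν V V')
    (hw : EvenGround α m μ' w w') (kw : OddGround α m ν' W W') (hgap : ν - μ ≤ ν' - μ')
    (hF : Continuous F.uncurry) (hFx : Continuous Fx.uncurry) (hFy : Continuous Fy.uncurry)
    (hx : ∀ x y, HasDerivAt (fun x => F x y) (Fx x y) x)
    (hy : ∀ x y, HasDerivAt (F x) (Fy x y) y) :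
    (ν + μ') * (∫ x in (-ℓ)..ℓ, ∫ y in (-m)..m, F x y ^ 2) -
      (ν - μ) / ((∫ x in (-ℓ)..ℓ, v x ^ 2) * ∫ y in (-m)..m, w y ^ 2) *
        (∫ x in (-ℓ)..ℓ, ∫ y in (-m)..m, F x y * (v x * w y)) ^ 2 ≤
      (∫ y in (-m)..m, robinForm α ℓ (fun x => F x y) (fun x => Fx x y)) +
      ∫ x in (-ℓ)..ℓ, robinForm α m (F x) (Fy x) := by
  have cv := continuous_of_hasDerivAt h.hasDeriv
  have cw := continuous_of_hasDerivAt hw.hasDeriv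
  have hv := h.integral_sq_pos hℓ
  have hw0 := hw.integral_sq_pos hm
  have X := h.gap_integral_robinForm hℓ hm k hF hFx hx
  have Y := hw.mean_integral_robinForm hℓ hm kw cv hv hF hFy hy
  have S := integral_swap_of_continuous (F := fun x y => F x y ^ 2) hF.uncurry_sq (-ℓ) ℓ (-m) m
  have hFv : Continuous (Function.uncurry fun x y => F x y * v x) :=
    hF.mul (cv.comp continuous_fst)
  have hFvw : Continuous (Function.uncurry fun x y => F x y * (v x * w y)) :=
    hF.mul ((cv.comp continuous_fst).mul (cw.comp continuous_snd))
  have D : ∫ x in (-ℓ)..ℓ, ∫ y in (-m)..m, F x y * (v x * w y) =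
      ∫ y in (-m)..m, (∫ x in (-ℓ)..ℓ, F x y * v x) * w y := by
    rw [integral_swap_of_continuous hFvw]
    refine intervalIntegral.integral_congr fun y _ => ?_
    rw [← intervalIntegral.integral_mul_const]
    exact intervalIntegral.integral_congr fun x _ => (mul_assoc _ _ _).symm
  have P := integral_mul_sq_div_le (a := -m) (b := m) (by linarith)
    (continuous_slice_integral hFv (-ℓ) ℓ).continuousOn cw hw0
  rw [D]
  set N := ∫ x in (-ℓ)..ℓ, ∫ y in (-m)..m, F x y ^ 2
  rw [← S] at X
  set c2 := ∫ y in (-m)..m, (∫ x in (-ℓ)..ℓ, F x y * v x) ^ 2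
  set d := ∫ y in (-m)..m, (∫ x in (-ℓ)..ℓ, F x y * v x) * w y
  set A := ∫ x in (-ℓ)..ℓ, v x ^ 2
  set B := ∫ y in (-m)..m, w y ^ 2
  -- The bound in `x` loses `(ν - μ) c2 / A`. The bound in `y` regains `(ν' - μ') (c2 - d² / B) /
  -- A`, and since its gap is at least as large, only the penalty along `v ⊗ w` remains.
  have Q : 0 ≤ ((ν' - μ') - (ν - μ)) / A * (c2 - d ^ 2 / B) :=
    mul_nonneg (div_nonneg (sub_nonneg.2 hgap) hv.le) (sub_nonneg.2 P)
  have e : (ν - μ) / (A * B) * d ^ 2 = (ν - μ) / A * (d ^ 2 / B) := by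
    field_simp
  have e' : ((ν' - μ') - (ν - μ)) / A * (c2 - d ^ 2 / B) =
    (ν' - μ') / A * (c2 - d ^ 2 / B) - (ν - μ) / A * c2 + (ν - μ) / A * (d ^ 2 / B) := by ring
  rw [e]
  linarith

end twoDim

/-! ### Products of interval modes as modes of the rectangle -/

theorem robinForm_mul_const (α ℓ c : ℝ) (f f' : ℝ → ℝ) :
    robinForm α ℓ (fun x => f x * c) (fun x => f' x * c) = c ^ 2 * robinForm α ℓ f f' := by
  simp only [robinForm, mul_pow, intervalIntegral.integral_mul_const]
  ring

theorem ContDiff.continuous_slices {φ : Plane → ℝ} (hφ : ContDiff ℝ ∞ φ) :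
    Continuous (Function.uncurry fun x y : ℝ => φ !₂[x, y]) :=
  hφ.continuous.comp continuous_planePoint

theorem contDiff_product {f g : ℝ → ℝ} (hf : ContDiff ℝ ∞ f) (hg : ContDiff ℝ ∞ g) :
    ContDiff ℝ ∞ fun p : Plane => f (p 0) * g (p 1) := by
  fun_prop

theorem EvenGround.first_planar_inequality {α ℓ m μ μ' : ℝ} (hℓ : 0 < ℓ) (hm : 0 < m)
    {v v' w w' : ℝ → ℝ} (h : EvenGround α ℓ μ v v') (hw : EvenGround α m μ' w w')
    {φ : Plane → ℝ} (hφ : ContDiff ℝ ∞ φ) :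
    (μ + μ') * (∫ p in centeredRectangle ℓ m, φ p ^ 2) ≤
      smoothEnergy (centeredRectangle ℓ m) α φ := by
  rw [smoothEnergy_centeredRectangle hℓ hm hφ (hasDerivAt_slice_fst hφ)
    (hasDerivAt_slice_snd hφ), setIntegral_centeredRectangle (f := fun p => φ p ^ 2) hℓ hm
    (hφ.continuous.pow 2)]
  have S := integral_swap_of_continuous (F := fun x y => φ !₂[x, y] ^ 2)
    hφ.continuous_slices.uncurry_sq (-ℓ) ℓ (-m) m
  have X := h.le_integral_robinForm hℓ hm hφ.continuous_slices
    (continuous_fderiv_planePoint hφ _) (hasDerivAt_slice_fst hφ)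
  have Y := hw.le_integral_robinForm (F := fun y x => φ !₂[x, y])
    (Fx := fun y x => fderiv ℝ φ !₂[x, y] (EuclideanSpace.single 1 1)) hm hℓ
    (hφ.continuous_slices.comp continuous_swap)
    ((continuous_fderiv_planePoint hφ _).comp continuous_swap)
    (fun y x => hasDerivAt_slice_snd hφ x y)
  rw [← S] at X
  linarith

theorem smoothEnergy_product {α ℓ m : ℝ} (hℓ : 0 < ℓ) (hm : 0 < m) {f f' g g' : ℝ → ℝ}
    (hf : ContDiff ℝ ∞ f) (hg : ContDiff ℝ ∞ g)
    (df : ∀ x, HasDerivAt f (f' x) x) (dg : ∀ x, HasDerivAt g (g' x) x) :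
    smoothEnergy (centeredRectangle ℓ m) α (fun p => f (p 0) * g (p 1)) =
      robinForm α ℓ f f' * (∫ y in (-m)..m, g y ^ 2) +
      (∫ x in (-ℓ)..ℓ, f x ^ 2) * robinForm α m g g' := by
  rw [smoothEnergy_centeredRectangle hℓ hm (contDiff_product hf hg)
    (Fx := fun x y => f' x * g y) (Fy := fun x y => g' y * f x)]
  · simp only [Matrix.cons_val_zero, Matrix.cons_val_one]
    have e : ∀ x, robinForm α m (fun y => f x * g y) (fun y => g' y * f x) =
        f x ^ 2 * robinForm α m g g' := fun x => by
      rw [← robinForm_mul_const]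
      simp only [mul_comm (f x)]
    simp_rw [e, robinForm_mul_const]
    rw [intervalIntegral.integral_mul_const, intervalIntegral.integral_mul_const]
    ring
  · intro x y
    simpa using (df x).mul_const (g y)
  · intro x y
    simpa [mul_comm] using (dg y).const_mul (f x)

theorem setIntegral_sq_product {ℓ m : ℝ} (hℓ : 0 < ℓ) (hm : 0 < m) {f g : ℝ → ℝ}
    (hf : Continuous f) (hg : Continuous g) :
    ∫ p in centeredRectangle ℓ m, (f (p 0) * g (p 1)) ^ 2 =
      (∫ x in (-ℓ)..ℓ, f x ^ 2) * ∫ y in (-m)..m, g y ^ 2 := by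
  rw [setIntegral_centeredRectangle (f := fun p => (f (p 0) * g (p 1)) ^ 2) hℓ hm (by fun_prop)]
  simp [mul_pow, intervalIntegral.integral_const_mul, intervalIntegral.integral_mul_const]

theorem EvenGround.robinForm_self {α ℓ μ ν : ℝ} (hℓ : 0 < ℓ) {v v' w w' : ℝ → ℝ}
    (h : EvenGround α ℓ μ v v') (k : OddGround α ℓ ν w w') :
    robinForm α ℓ v v' = μ * ∫ x in (-ℓ)..ℓ, v x ^ 2 := by
  simpa using h.robinForm_add hℓ k 1 0

theorem robinModes_centeredRectangle {α ℓ m μ ν μ' ν' : ℝ} (hℓ : 0 < ℓ) (hm : 0 < m)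
    {v v' V V' w w' W W' : ℝ → ℝ} (h : EvenGround α ℓ μ v v') (k : OddGround α ℓ ν V V')
    (hw : EvenGround α m μ' w w') (kw : OddGround α m ν' W W') (hgap : ν - μ ≤ ν' - μ') :
    ∃ A B δ C u₁ u₂, RobinModes (centeredRectangle ℓ m) α (μ + μ') (ν + μ') A B δ C u₁ u₂ := by
  -- The first Robin inequality with parameter `-1` is a trace inequality, with constant `C = -(κ +
  -- κ')`.
  obtain ⟨κ, _, _, -, hκ⟩ := exists_evenGround (α := -1) (by norm_num) hℓ
  obtain ⟨κ', _, _, -, hκ'⟩ := exists_evenGround (α := -1) (by norm_num) hm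
  have sv := contDiff_of_ode h.hasDeriv h.hasDeriv'
  have sV := contDiff_of_ode k.hasDeriv k.hasDeriv'
  have sw := contDiff_of_ode hw.hasDeriv hw.hasDeriv'
  have hA := h.integral_sq_pos hℓ
  have hB := k.integral_sq_pos hℓ
  have hW := hw.integral_sq_pos hm
  have sc : ∀ s t : ℝ, ContDiff ℝ ∞ fun x => s * v x + t * V x := fun s t =>
    (contDiff_const.mul sv).add (contDiff_const.mul sV)
  have comb : ∀ s t : ℝ, (fun p : Plane => s * (v (p 0) * w (p 1)) + t * (V (p 0) * w (p 1))) =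
      fun p => (fun x => s * v x + t * V x) (p 0) * w (p 1) := fun s t => by
    funext p; ring
  refine ⟨(∫ x in (-ℓ)..ℓ, v x ^ 2) * ∫ y in (-m)..m, w y ^ 2,
    (∫ x in (-ℓ)..ℓ, V x ^ 2) * ∫ y in (-m)..m, w y ^ 2,
    (ν - μ) / ((∫ x in (-ℓ)..ℓ, v x ^ 2) * ∫ y in (-m)..m, w y ^ 2), -(κ + κ'),
    fun p => v (p 0) * w (p 1), fun p => V (p 0) * w (p 1), ?_⟩
  constructor
  · exact contDiff_product sv sw
  · exact contDiff_product sV sw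
  · positivity
  · positivity
  · linarith [h.lt_of_oddGround hℓ k]
  · exact fun φ hφ => h.first_planar_inequality hℓ hm hw hφ
  · intro φ hφ
    have cv := sv.continuous
    have cw := sw.continuous
    have cφ := hφ.continuous
    rw [smoothEnergy_centeredRectangle hℓ hm hφ (hasDerivAt_slice_fst hφ)
      (hasDerivAt_slice_snd hφ), setIntegral_centeredRectangle (f := fun p => φ p ^ 2) hℓ hm
      (cφ.pow 2), setIntegral_centeredRectangle (f := fun p => φ p * (v (p 0) * w (p 1)))
      hℓ hm (by fun_prop)]
    exact second_robin_inequality hℓ hm h k hw kw hgap hφ.continuous_slices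
      (continuous_fderiv_planePoint hφ _) (continuous_fderiv_planePoint hφ _)
      (hasDerivAt_slice_fst hφ) (hasDerivAt_slice_snd hφ)
  · intro φ hφ
    have := hκ.first_planar_inequality hℓ hm hκ' hφ
    rw [smoothEnergy] at this
    linarith
  · intro s t
    rw [comb, smoothEnergy_product hℓ hm (sc s t) sw
      (fun x => ((h.hasDeriv x).const_mul s).add ((k.hasDeriv x).const_mul t)) hw.hasDeriv,
      h.robinForm_add hℓ k, h.integral_add_sq hℓ k, hw.robinForm_self hm kw]
    ring
  · intro s t
    have e : ∀ p : Plane, s * (v (p 0) * w (p 1)) + t * (V (p 0) * w (p 1)) =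
        (fun x => s * v x + t * V x) (p 0) * w (p 1) := fun p => congrFun (comb s t) p
    simp_rw [e]
    rw [setIntegral_sq_product (f := fun x => s * v x + t * V x) hℓ hm (sc s t).continuous
      sw.continuous, h.integral_add_sq hℓ k]
    ring

/-! ### Congruent rectangles and the conclusion -/

theorem AreCongruent.symm {R S : Set Plane} (h : AreCongruent R S) : AreCongruent S R := by
  obtain ⟨e, rfl⟩ := h
  exact ⟨e.symm, by rw [← image_comp]; simp⟩

theorem AreCongruent.trans {R S T : Set Plane} (h : AreCongruent R S) (k : AreCongruent S T) :
    AreCongruent R T := by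
  obtain ⟨e, rfl⟩ := h
  obtain ⟨f, rfl⟩ := k
  exact ⟨e.trans f, by rw [← image_comp]; rfl⟩

theorem areCongruent_swap (ℓ m : ℝ) :
    AreCongruent (centeredRectangle ℓ m) (centeredRectangle m ℓ) := by
  refine ⟨(LinearIsometryEquiv.piLpCongrLeft 2 ℝ ℝ (Equiv.swap (0 : Fin 2) 1)).toIsometryEquiv, ?_⟩
  ext p
  rw [← IsometryEquiv.preimage_symm]
  simp only [centeredRectangle, mem_preimage, mem_ofPred_eq]
  exact and_comm

theorem areCongruent_centeredRectangle {a b : ℝ} :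
    AreCongruent (centeredRectangle (a / 2) (b / 2))
      {x : Plane | x 0 ∈ Ioo 0 a ∧ x 1 ∈ Ioo 0 b} := by
  refine ⟨IsometryEquiv.addRight !₂[a / 2, b / 2], ?_⟩
  ext p
  rw [← IsometryEquiv.preimage_symm]
  simp only [centeredRectangle, mem_preimage, mem_ofPred_eq, IsometryEquiv.addRight_symm,
    IsometryEquiv.addRight_apply, mem_Ioo]
  simp

/-- Every rectangle is congruent to a centered one whose first side is the longer one. -/
theorem IsRectangle.exists_centered {R : Set Plane} (h : IsRectangle R) :
    ∃ ℓ m, 0 < m ∧ m ≤ ℓ ∧ AreCongruent (centeredRectangle ℓ m) R := by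
  obtain ⟨a, b, ha, hb, hab⟩ := h
  have hc := areCongruent_centeredRectangle.trans hab
  rcases le_total b a with h | h
  · exact ⟨a / 2, b / 2, by positivity, by linarith, hc⟩
  · exact ⟨b / 2, a / 2, by positivity, by linarith, (areCongruent_swap _ _).trans hc⟩

/-- The first two Robin eigenvalues of a rectangle in terms of those of its sides. -/
theorem robinEigenvalue_rectangle {α ℓ m μ ν μ' ν' : ℝ} (hℓ : 0 < ℓ) (hm : 0 < m)
    {v v' V V' w w' W W' : ℝ → ℝ} (h : EvenGround α ℓ μ v v') (k : OddGround α ℓ ν V V')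
    (hw : EvenGround α m μ' w w') (kw : OddGround α m ν' W W') (hgap : ν - μ ≤ ν' - μ')
    {R : Set Plane} (hR : AreCongruent (centeredRectangle ℓ m) R) :
    robinEigenvalue R α 1 = μ + μ' ∧ robinEigenvalue R α 2 = ν + μ' := by
  obtain ⟨e, rfl⟩ := hR
  have T := (isTameDomain_centeredRectangle hℓ hm).image e
  obtain ⟨A, B, δ, C, u₁, u₂, M⟩ := robinModes_centeredRectangle hℓ hm h k hw kw hgap
  exact ⟨(M.image e).robinEigenvalue_one T, (M.image e).robinEigenvalue_two T⟩

theorem mainTheorem8 (α : ℝ) (hα : α ≠ 0) (R S : Set Plane)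
    (hR : IsRectangle R) (hS : IsRectangle S)
    (h₁ : robinEigenvalue R α 1 = robinEigenvalue S α 1)
    (h₂ : robinEigenvalue R α 2 = robinEigenvalue S α 2) :
    AreCongruent R S := by
  -- One mode of each kind is fixed for every length. Uniqueness of the interval eigenvalues is not
  -- needed, since equal lengths share the same choice.
  choose μ v v' hμ h using fun (ℓ : ℝ) (hℓ : 0 < ℓ) => exists_evenGround hα hℓ
  choose ν w w' k using fun (ℓ : ℝ) (hℓ : 0 < ℓ) => exists_oddGround hα hℓ
  obtain ⟨ℓ, m, hm, hℓm, cR⟩ := hR.exists_centered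
  obtain ⟨ℓ', m', hm', hℓm', cS⟩ := hS.exists_centered
  have hℓ := hm.trans_le hℓm
  have hℓ' := hm'.trans_le hℓm'
  have lt : ∀ {a b : ℝ} (ha : 0 < a) (hb : 0 < b), a < b → ν b hb - μ b hb < ν a ha - μ a ha :=
    fun ha hb hab => gap_lt (hμ _ hb) ha hab (h _ ha) (k _ ha) (h _ hb) (k _ hb)
  have le : ∀ {a b : ℝ} (ha : 0 < a) (hb : 0 < b), a ≤ b → ν b hb - μ b hb ≤ ν a ha - μ a ha := by
    intro a b ha hb hab
    rcases hab.eq_or_lt with rfl | hab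
    · exact le_rfl
    · exact (lt ha hb hab).le
  obtain ⟨R1, R2⟩ := robinEigenvalue_rectangle hℓ hm (h _ hℓ) (k _ hℓ) (h _ hm) (k _ hm)
    (le hm hℓ hℓm) cR
  obtain ⟨S1, S2⟩ := robinEigenvalue_rectangle hℓ' hm' (h _ hℓ') (k _ hℓ') (h _ hm') (k _ hm')
    (le hm' hℓ' hℓm') cS
  rw [R1, S1] at h₁
  rw [R2, S2] at h₂
  -- Subtracting `h₁` from `h₂` equates the gaps of the two long sides.
  obtain rfl : ℓ = ℓ' := by
    rcases lt_trichotomy ℓ ℓ' with hlt | heq | hlt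
    · linarith [lt hℓ hℓ' hlt]
    · exact heq
    · linarith [lt hℓ' hℓ hlt]
  -- With the long sides equal, `h₁` equates the ground-state eigenvalues of the short sides.
  obtain rfl : m = m' := by
    have e : μ m hm = μ m' hm' := by linarith
    rcases lt_trichotomy m m' with hlt | heq | hlt
    · exact absurd e ((h _ hm).eigenvalue_ne (hμ _ hm') hm hlt (h _ hm'))
    · exact heq
    · exact absurd e.symm ((h _ hm').eigenvalue_ne (hμ _ hm) hm' hlt (h _ hm))
  exact cR.symm.trans cS
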